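/- Let $n\ge 1$ and let $\mathcal H=L^2(\mathbb R^n)$ be the Hilbert space of $n$ bosonic modes, with $Q_j$ the multiplication by $x_j$ and $P_j=-i\,\partial/\partial x_j$. For $k=(a,b)\in\mathbb R^{n}\times\mathbb R^{n}$ let $e^{ik\cdot R}=e^{i(a\cdot Q+b\cdot P)}$ be the Weyl operator, $(e^{ik\cdot R}\psi)(x)=e^{i(a\cdot x+a\cdot b/2)}\,\psi(x+b)$. Let $\mathfrak T$ be the set of bounded operators $X$ on $\mathcal H$ with finite trace norm $\|X\|_1=\mathrm{Tr}\sqrt{X^\dagger X}$, and for $X\in\mathfrak T$ let $\chi_X(k)=\mathrm{Tr}\,(X\,e^{ik\cdot R})$ be its characteristic function. For $\lambda\in\mathbb R$, an operator $Y\in\mathfrak T$ is the image $\Theta_\lambda(X)$ of $X\in\mathfrak T$ under the phase-space dilatation by $\lambda$ if $\chi_Y(k)=\chi_X(\lambda k)$ for all $k\in\mathbb R^{2n}$; for $\lambda\neq0$ this means $W_Y(r)=\lambda^{-2n}\,W_X(r/\lambda)$ for the Wigner functions. **Theorem.** For any real $\lambda\neq\pm1$, the phase-space dilatation by $\lambda$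 is not bounded on the Banach space $\mathfrak T$ of trace-class operators: there is no constant $C<\infty$ such that for every $X\in\mathfrak T$ the image $\Theta_\lambda(X)$ exists in $\mathfrak T$ and $\|\Theta_\lambda(X)\|_1\le C\,\|X\|_1$. If moreover $\lambda\neq 0$, it is unbounded already on the operators whose image is trace-class: for every $C<\infty$ there is $X\in\mathfrak T$ such that $\Theta_\lambda(X)$ exists in $\mathfrak T$ and $\|\Theta_\lambda(X)\|_1> C\,\|X\|_1$. -/

import Mathlib

open MeasureTheory
open scoped ENNReal NNReal InnerProductSpace

namespace PhaseSpace

/-! ### Trace norm and trace on a complex Hilbert space -/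

section TraceClass

/-- The index set of a fixed orthonormal (Hilbert) basis of `H`. -/
def basisIndex (H : Type*) [NormedAddCommGroup H] [InnerProductSpace ℂ H] [CompleteSpace H] :
    Set H :=
  Classical.choose (exists_hilbertBasis ℂ H)

/-- A fixed orthonormal (Hilbert) basis of `H`.  The trace norm, and the trace of a trace-class
operator, do not depend on it. -/
noncomputable def basis (H : Type*) [NormedAddCommGroup H] [InnerProductSpace ℂ H]
    [CompleteSpace H] : HilbertBasis (basisIndex H) ℂ H :=
  Classical.choose (Classical.choose_spec (exists_hilbertBasis ℂ H))

/-- The trace norm `‖X‖₁ = Tr √(X† X) = ∑ i, ⟪e i, |X| (e i)⟫`, with values in `[0, ∞]`.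
Here `CFC.abs X = √(X† X)` is the positive square root. -/
noncomputable def traceNorm {H : Type*} [NormedAddCommGroup H] [InnerProductSpace ℂ H]
    [CompleteSpace H] (X : H →L[ℂ] H) : ℝ≥0∞ :=
  ∑' i, ENNReal.ofReal (⟪basis H i, CFC.abs X (basis H i)⟫_ℂ).re

/-- `X` is trace-class if its trace norm is finite. -/
def IsTraceClass {H : Type*} [NormedAddCommGroup H] [InnerProductSpace ℂ H]
    [CompleteSpace H] (X : H →L[ℂ] H) : Prop :=
  traceNorm X < ∞

/-- The trace `Tr X = ∑ i, ⟪e i, X (e i)⟫` (the series converges absolutely when `X` is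
trace-class). -/
noncomputable def trace {H : Type*} [NormedAddCommGroup H] [InnerProductSpace ℂ H]
    [CompleteSpace H] (X : H →L[ℂ] H) : ℂ :=
  ∑' i, ⟪basis H i, X (basis H i)⟫_ℂ

end TraceClass

/-! ### The `n`-mode bosonic system in the Schrödinger representation -/

/-- The Hilbert space `L²(ℝⁿ)` of `n` bosonic modes. -/
abbrev Hilb (n : ℕ) : Type := Lp ℂ 2 (volume : Measure (Fin n → ℝ))

/-- A vector `k` of the `2n`-dimensional phase space, written `k = (a, b)`, so that
`k · R = ∑ j, (a j Q j + b j P j)`. -/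
abbrev Phase (n : ℕ) : Type := (Fin n → ℝ) × (Fin n → ℝ)

/-- The phase factor `e^{i (a·x + a·b/2)}`. -/
noncomputable def weylPhase {n : ℕ} (k : Phase n) (x : Fin n → ℝ) : ℂ :=
  Complex.exp (Complex.I * ((k.1 ⬝ᵥ x + (k.1 ⬝ᵥ k.2) / 2 : ℝ) : ℂ))

theorem norm_weylPhase {n : ℕ} (k : Phase n) (x : Fin n → ℝ) : ‖weylPhase k x‖ = 1 := by
  rw [weylPhase, mul_comm, Complex.norm_exp_ofReal_mul_I]

theorem continuous_weylPhase {n : ℕ} (k : Phase n) : Continuous (weylPhase k) := by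
  unfold weylPhase dotProduct
  fun_prop

/-- The function `x ↦ e^{i (a·x + a·b/2)} ψ(x + b)`. -/
noncomputable def weylFun {n : ℕ} (k : Phase n) (ψ : (Fin n → ℝ) → ℂ) (x : Fin n → ℝ) : ℂ :=
  weylPhase k x * ψ (x + k.2)

theorem eLpNorm_weylFun {n : ℕ} (k : Phase n) {ψ : (Fin n → ℝ) → ℂ}
    (hψ : AEStronglyMeasurable ψ volume) :
    eLpNorm (weylFun k ψ) 2 volume = eLpNorm ψ 2 volume := by
  rw [← eLpNorm_comp_measurePreserving (p := 2) hψ (measurePreserving_add_right volume k.2)]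
  refine eLpNorm_congr_norm_ae (Filter.Eventually.of_forall fun x => ?_)
  simp [weylFun, norm_weylPhase]

theorem memLp_weylFun {n : ℕ} (k : Phase n) {ψ : (Fin n → ℝ) → ℂ} (hψ : MemLp ψ 2 volume) :
    MemLp (weylFun k ψ) 2 volume := by
  refine ⟨?_, ?_⟩
  · exact (continuous_weylPhase k).aestronglyMeasurable.mul
      (hψ.1.comp_measurePreserving (measurePreserving_add_right volume k.2))
  · rw [eLpNorm_weylFun k hψ.1]
    exact hψ.2

theorem weylFun_congr {n : ℕ} (k : Phase n) {ψ φ : (Fin n → ℝ) → ℂ} (h : ψ =ᵐ[volume] φ) :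
    weylFun k ψ =ᵐ[volume] weylFun k φ := by
  have := (measurePreserving_add_right (volume : Measure (Fin n → ℝ))
    k.2).quasiMeasurePreserving.ae_eq_comp h
  filter_upwards [this] with x hx
  simp only [Function.comp_apply] at hx
  simp [weylFun, hx]

/-- The Weyl operator `e^{i k·R} = e^{i (a·Q + b·P)}` as a linear isometry of `L²(ℝⁿ)`, where
`Q j` is multiplication by `x j` and `P j = -i ∂/∂x j`; explicitly
`(e^{i k·R} ψ)(x) = e^{i (a·x + a·b/2)} ψ(x + b)`. -/
noncomputable def weylIsometry {n : ℕ} (k : Phase n) : Hilb n →ₗᵢ[ℂ] Hilb n where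
  toFun ψ := (memLp_weylFun k (Lp.memLp ψ)).toLp (weylFun k ψ)
  map_add' ψ φ := by
    rw [← MemLp.toLp_add]
    refine MemLp.toLp_congr _ _ ((weylFun_congr k (Lp.coeFn_add ψ φ)).trans ?_)
    exact Filter.Eventually.of_forall fun x => by simp [weylFun, mul_add]
  map_smul' c ψ := by
    rw [RingHom.id_apply, ← MemLp.toLp_const_smul]
    refine MemLp.toLp_congr _ _ ((weylFun_congr k (Lp.coeFn_smul c ψ)).trans ?_)
    exact Filter.Eventually.of_forall fun x => by
      simp only [weylFun, Pi.smul_apply, smul_eq_mul]; ring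
  norm_map' ψ := by
    change ‖(memLp_weylFun k (Lp.memLp ψ)).toLp (weylFun k ψ)‖ = ‖ψ‖
    rw [Lp.norm_toLp, eLpNorm_weylFun k (Lp.aestronglyMeasurable ψ), Lp.norm_def]

/-- The Weyl operator `e^{i k·R}` as a bounded operator. -/
noncomputable def weyl {n : ℕ} (k : Phase n) : Hilb n →L[ℂ] Hilb n :=
  (weylIsometry k).toContinuousLinearMap

theorem weyl_apply_ae {n : ℕ} (k : Phase n) (ψ : Hilb n) :
    weyl k ψ =ᵐ[volume] weylFun k ψ :=
  MemLp.coeFn_toLp (memLp_weylFun k (Lp.memLp ψ))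

/-- The characteristic function `χ_X(k) = Tr (X e^{i k·R})`. -/
noncomputable def charFn {n : ℕ} (X : Hilb n →L[ℂ] Hilb n) (k : Phase n) : ℂ :=
  trace (X ∘L weyl k)

/-- `Y` is the image of `X` under the phase-space dilatation by `l`:
`χ_Y(k) = χ_X(l k)` for every `k`.  By Fourier transform this is `W_Y(x) = W_X(x / l) / l ^ (2n)`
for the Wigner functions when `l ≠ 0`.  Among trace-class operators, `Y` is determined by `X`. -/
def IsDilatation {n : ℕ} (l : ℝ) (X Y : Hilb n →L[ℂ] Hilb n) : Prop :=
  ∀ k : Phase n, charFn Y k = charFn X (l • k)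

end PhaseSpace

/-! Suppose `l ≠ 0`. Let `X_ξ = |g_ξ⟩⟨g_0|` be built from Gaussians of momenta `ξ` and `0`. Its
Wigner function sits at mean momentum `ξ / 2` and oscillates in position with frequency `ξ`.
Dilatation turns these into `l ξ / 2` and `ξ / l`, so the image carries momentum `c ξ` on the left
and `-s ξ` on the right, where `c - s = l` and `c + s = 1 / l`. If `l ≠ ±1` then `s ≠ 0`, and the
right momentum varies with `ξ` too.

Sum over `N` widely separated momenta. The operator `X = |∑ g_ξ⟩⟨g_0|` has rank one and trace norm
of order `√N`, the kets being almost orthogonal. Its image couples `N` almost orthogonal vectors on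
the left to `N` almost orthogonal vectors on the right, each pair with the same strength `D`, so its
trace norm is at least of order `N`. The ratio is unbounded.

The image is an explicit Gaussian mixture of rank-one operators (`exists_dilatation_gauss`). The
lower bound pairs an operator with two Bessel families (`IsTraceClass.sum_norm_inner_le`,
`gauss_bessel`). It holds for every trace-class image, because Gaussian matrix elements are
integrals of the characteristic function (`inner_gauss_eq_integral_charFn`).

For `l = 0` the image would have a constant characteristic function, as a multiple of the parity
operator would. Its matrix elements from momentum `ξ` to `-ξ` then have constant modulus, which no
nonzero constant allows for a trace-class operator (`IsTraceClass.eq_zero_of_charFn_const`). -/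

namespace PhaseSpace

/-! ### Bessel-type inequalities and the polar decomposition -/

section HilbertSpace

variable {H : Type*} [NormedAddCommGroup H] [InnerProductSpace ℂ H]

/-- Cauchy–Schwarz for two finite families that satisfy Bessel's inequality with constant `K`. -/
theorem sum_norm_inner_mul_le {ι : Type*} (s : Finset ι) {u v : ι → H} {K : ℝ} {x y : H}
    (hK : 0 ≤ K)
    (hu : ∑ i ∈ s, ‖⟪u i, x⟫_ℂ‖ ^ 2 ≤ K * ‖x‖ ^ 2) (hv : ∑ i ∈ s, ‖⟪v i, y⟫_ℂ‖ ^ 2 ≤ K * ‖y‖ ^ 2) :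
    ∑ i ∈ s, ‖⟪u i, x⟫_ℂ‖ * ‖⟪y, v i⟫_ℂ‖ ≤ K * (‖x‖ * ‖y‖) := by
  simp_rw [norm_inner_symm y]
  refine (Real.sum_mul_le_sqrt_mul_sqrt s _ _).trans ?_
  refine (mul_le_mul (Real.sqrt_le_sqrt hu) (Real.sqrt_le_sqrt hv) (Real.sqrt_nonneg _)
    (Real.sqrt_nonneg _)).trans (le_of_eq ?_)
  rw [Real.sqrt_mul hK, Real.sqrt_mul hK, Real.sqrt_sq (norm_nonneg _),
    Real.sqrt_sq (norm_nonneg _), mul_mul_mul_comm, Real.mul_self_sqrt hK]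

theorem sum_norm_inner_mul_le_of_orthonormal {ι : Type*} (s : Finset ι) {e : ι → H}
    (he : Orthonormal ℂ e) (x y : H) :
    ∑ i ∈ s, ‖⟪e i, x⟫_ℂ‖ * ‖⟪y, e i⟫_ℂ‖ ≤ ‖x‖ * ‖y‖ := by
  simpa using sum_norm_inner_mul_le s zero_le_one
    (by simpa using he.sum_inner_products_le x) (by simpa using he.sum_inner_products_le y)

/-- A finite family of vectors with almost diagonal Gram matrix satisfies Bessel's inequality. -/
theorem sum_norm_inner_sq_le_of_gram {ι : Type*} (s : Finset ι) (u : ι → H) {K : ℝ} (hK0 : 0 ≤ K)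
    (hK : ∀ i ∈ s, ∑ j ∈ s, ‖⟪u i, u j⟫_ℂ‖ ≤ K) (x : H) :
    ∑ i ∈ s, ‖⟪u i, x⟫_ℂ‖ ^ 2 ≤ K * ‖x‖ ^ 2 := by
  set S := ∑ i ∈ s, ‖⟪u i, x⟫_ℂ‖ ^ 2 with hS
  have hS0 : 0 ≤ S := Finset.sum_nonneg fun _ _ => by positivity
  -- Duality: `⟪w, x⟫ = S`, while the Schur test on the Gram matrix gives `‖w‖² ≤ K S`.
  -- Cauchy–Schwarz then yields `S² ≤ K S ‖x‖²`.
  set w : H := ∑ i ∈ s, ⟪u i, x⟫_ℂ • u i with hw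
  have h1 : ⟪w, x⟫_ℂ = (S : ℂ) := by
    rw [hw, sum_inner, hS]
    push_cast
    refine Finset.sum_congr rfl fun i _ => ?_
    rw [inner_smul_left, Complex.conj_mul']
  have h2 : ‖w‖ ^ 2 ≤ K * S := by
    have h3 : (‖w‖ ^ 2 : ℝ) = ‖⟪w, w⟫_ℂ‖ := by
      rw [inner_self_eq_norm_sq_to_K]; simp
    rw [h3, hw, sum_inner]
    simp_rw [inner_sum, inner_smul_left, inner_smul_right]
    refine (norm_sum_le _ _).trans ?_
    have h4 : ∀ i ∈ s, ‖∑ j ∈ s, (starRingEnd ℂ) ⟪u i, x⟫_ℂ * (⟪u j, x⟫_ℂ * ⟪u i, u j⟫_ℂ)‖ ≤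
        ∑ j ∈ s, (‖⟪u i, x⟫_ℂ‖ ^ 2 / 2 * ‖⟪u i, u j⟫_ℂ‖ +
          ‖⟪u j, x⟫_ℂ‖ ^ 2 / 2 * ‖⟪u j, u i⟫_ℂ‖) := by
      intro i _
      refine (norm_sum_le _ _).trans (Finset.sum_le_sum fun j _ => ?_)
      rw [norm_mul, norm_mul, RCLike.norm_conj, norm_inner_symm (u j) (u i)]
      nlinarith [mul_nonneg (sq_nonneg (‖⟪u i, x⟫_ℂ‖ - ‖⟪u j, x⟫_ℂ‖)) (norm_nonneg ⟪u i, u j⟫_ℂ)]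
    refine (Finset.sum_le_sum h4).trans ?_
    simp_rw [Finset.sum_add_distrib]
    rw [Finset.sum_comm (f := fun i j => ‖⟪u j, x⟫_ℂ‖ ^ 2 / 2 * ‖⟪u j, u i⟫_ℂ‖)]
    rw [← two_mul]
    simp_rw [← Finset.mul_sum]
    have h5 : ∑ i ∈ s, ‖⟪u i, x⟫_ℂ‖ ^ 2 / 2 * ∑ j ∈ s, ‖⟪u i, u j⟫_ℂ‖ ≤
        ∑ i ∈ s, ‖⟪u i, x⟫_ℂ‖ ^ 2 / 2 * K :=
      Finset.sum_le_sum fun i hi => mul_le_mul_of_nonneg_left (hK i hi) (by positivity)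
    rw [← Finset.sum_mul, ← Finset.sum_div, ← hS] at h5
    linarith
  have h6 : S ≤ ‖w‖ * ‖x‖ := by
    have := norm_inner_le_norm (𝕜 := ℂ) w x
    rwa [h1, Complex.norm_real, Real.norm_of_nonneg hS0] at this
  have h7 : S ^ 2 ≤ (K * S) * ‖x‖ ^ 2 := by
    calc S ^ 2 ≤ (‖w‖ * ‖x‖) ^ 2 := pow_le_pow_left₀ hS0 h6 2
      _ = ‖w‖ ^ 2 * ‖x‖ ^ 2 := by ring
      _ ≤ _ := mul_le_mul_of_nonneg_right h2 (by positivity)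
  rcases hS0.eq_or_lt with h0 | h0
  · rw [← h0]; positivity
  · refine le_of_mul_le_mul_left ?_ h0
    linarith

variable [CompleteSpace H]

theorem norm_cfcAbs_apply (X : H →L[ℂ] H) (x : H) : ‖CFC.abs X x‖ = ‖X x‖ := by
  have hsa : star (CFC.abs X) = CFC.abs X := (CFC.abs_nonneg X).isSelfAdjoint.star_eq
  have h : ⟪CFC.abs X x, CFC.abs X x⟫_ℂ = ⟪X x, X x⟫_ℂ := by
    have h1 := congrArg (fun T : H →L[ℂ] H => ⟪x, T x⟫_ℂ) (CFC.abs_mul_abs X)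
    simp only [mul_apply_eq_comp] at h1
    rw [ContinuousLinearMap.star_eq_adjoint, ContinuousLinearMap.adjoint_inner_right] at h1
    rw [← h1, ← ContinuousLinearMap.adjoint_inner_right, ← ContinuousLinearMap.star_eq_adjoint, hsa]
  rw [inner_self_eq_norm_sq_to_K, inner_self_eq_norm_sq_to_K] at h
  have h2 : ‖CFC.abs X x‖ ^ 2 = ‖X x‖ ^ 2 := by exact_mod_cast h
  exact (pow_left_inj₀ (norm_nonneg _) (norm_nonneg _) two_ne_zero).1 h2

/-- Polar decomposition of a bounded operator. -/
theorem exists_polar (X : H →L[ℂ] H) :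
    ∃ U : H →L[ℂ] H, (∀ x, ‖U x‖ ≤ ‖x‖) ∧ (∀ x, U (CFC.abs X x) = X x) ∧
      ∀ x, ContinuousLinearMap.adjoint U (X x) = CFC.abs X x := by
  -- `|X| x ↦ X x` is isometric on the range of `|X|`. It extends to the closure `K` of that range,
  -- and by zero to the orthogonal complement of `K`.
  set A : H →ₗ[ℂ] H := (CFC.abs X : H →L[ℂ] H).toLinearMap with hA
  set K := (LinearMap.range A).topologicalClosure with hK
  have hKc : CompleteSpace K := (Submodule.isClosed_topologicalClosure _).completeSpace_coe
  have hmem : ∀ x, A x ∈ K := fun x => Submodule.le_topologicalClosure _ ⟨x, rfl⟩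
  let e : H →ₗ[ℂ] K := A.codRestrict K hmem
  have hdense : DenseRange e := by
    intro y
    have hy : (y : H) ∈ closure (LinearMap.range A : Set H) := y.2
    rw [Metric.mem_closure_iff] at hy ⊢
    intro ε hε
    obtain ⟨_, ⟨x, rfl⟩, hb⟩ := hy ε hε
    exact ⟨e x, ⟨x, rfl⟩, hb⟩
  have hnorm : ∀ x, ‖X.toLinearMap x‖ ≤ 1 * ‖e x‖ := by
    intro x
    have : ‖e x‖ = ‖CFC.abs X x‖ := rfl
    rw [one_mul, this, norm_cfcAbs_apply]; rfl
  set V : K →L[ℂ] H := X.toLinearMap.extendOfNorm e with hV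
  have hVe : ∀ x, V (e x) = X x := fun x =>
    LinearMap.extendOfNorm_eq hdense ⟨1, hnorm⟩ x
  have hVn : ∀ y, ‖V y‖ ≤ ‖y‖ := fun y => by
    simpa using LinearMap.norm_extendOfNorm_apply_le hdense 1 hnorm y
  set U : H →L[ℂ] H := V ∘L K.orthogonalProjectionOnto with hU
  have hU1 : ∀ x, ‖U x‖ ≤ ‖x‖ := fun x =>
    (hVn _).trans (K.norm_orthogonalProjectionOnto_apply_le x)
  have hU2 : ∀ x, U (CFC.abs X x) = X x := fun x => by
    have : K.orthogonalProjectionOnto (CFC.abs X x) = e x :=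
      Submodule.orthogonalProjectionOnto_mem_subspace_eq_self (e x)
    rw [hU, ContinuousLinearMap.comp_apply, this, hVe]
  refine ⟨U, hU1, hU2, fun x => ?_⟩
  set y := CFC.abs X x with hy
  have hUn : ‖ContinuousLinearMap.adjoint U‖ ≤ 1 := by
    rw [LinearIsometryEquiv.norm_map]
    exact U.opNorm_le_bound zero_le_one (by simpa using hU1)
  have hyn : ‖X x‖ = ‖y‖ := (norm_cfcAbs_apply X x).symm
  have h1 : ‖ContinuousLinearMap.adjoint U (X x)‖ ≤ ‖y‖ := by
    rw [← hyn]; simpa using ContinuousLinearMap.le_of_opNorm_le _ hUn (X x)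
  -- A vector of norm at most `‖y‖` whose inner product with `y` has real part `‖y‖²` must equal
  -- `y`.
  have h2 : RCLike.re ⟪ContinuousLinearMap.adjoint U (X x), y⟫_ℂ = ‖y‖ ^ 2 := by
    rw [ContinuousLinearMap.adjoint_inner_left, hU2, inner_self_eq_norm_sq, hyn]
  have h3 := norm_sub_sq (𝕜 := ℂ) (ContinuousLinearMap.adjoint U (X x)) y
  rw [h2] at h3
  have h4 : ‖ContinuousLinearMap.adjoint U (X x) - y‖ ^ 2 ≤ 0 := by
    have := pow_le_pow_left₀ (norm_nonneg _) h1 2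
    linarith
  have h5 : ‖ContinuousLinearMap.adjoint U (X x) - y‖ = 0 :=
    pow_eq_zero_iff two_ne_zero |>.1 (le_antisymm h4 (by positivity))
  exact sub_eq_zero.1 (norm_eq_zero.1 h5)

end HilbertSpace

/-! ### Trace-class operators as integrals of rank-one operators -/

section Nuclear

variable {H : Type*} [NormedAddCommGroup H] [InnerProductSpace ℂ H]

/-- `X` is the weak integral of the rank-one operators `|p t⟩⟨q t|`, with integrable trace norm. -/
structure IsNuclear {T : Type*} [MeasurableSpace T] (μ : Measure T) (p q : T → H)
    (X : H →L[ℂ] H) : Prop where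
  aesm_left : AEStronglyMeasurable p μ
  aesm_right : AEStronglyMeasurable q μ
  integrable_norm : Integrable (fun t => ‖p t‖ * ‖q t‖) μ
  inner_apply : ∀ φ ψ, ⟪φ, X ψ⟫_ℂ = ∫ t, ⟪φ, p t⟫_ℂ * ⟪q t, ψ⟫_ℂ ∂μ

namespace IsNuclear

variable {T : Type*} [MeasurableSpace T] {μ : Measure T} {p q : T → H} {X : H →L[ℂ] H}

theorem integrable_inner (h : IsNuclear μ p q X) (φ ψ : H) :
    Integrable (fun t => ⟪φ, p t⟫_ℂ * ⟪q t, ψ⟫_ℂ) μ := by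
  refine (h.integrable_norm.const_mul (‖φ‖ * ‖ψ‖)).mono'
    ((aestronglyMeasurable_const.inner h.aesm_left).mul
      (h.aesm_right.inner aestronglyMeasurable_const)) (.of_forall fun t => ?_)
  rw [norm_mul]
  calc _ ≤ (‖φ‖ * ‖p t‖) * (‖q t‖ * ‖ψ‖) := by gcongr <;> exact norm_inner_le_norm _ _
    _ = _ := by ring

theorem norm_inner_apply_le (h : IsNuclear μ p q X) (φ ψ : H) :
    ‖⟪φ, X ψ⟫_ℂ‖ ≤ ∫ t, ‖⟪φ, p t⟫_ℂ‖ * ‖⟪q t, ψ⟫_ℂ‖ ∂μ := by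
  rw [h.inner_apply]
  simpa only [norm_mul] using norm_integral_le_integral_norm (μ := μ)
    (fun t => ⟪φ, p t⟫_ℂ * ⟪q t, ψ⟫_ℂ)

/-- A nuclear operator has a bounded pairing with finite families that satisfy Bessel's
inequality. -/
theorem sum_integral_norm_le (h : IsNuclear μ p q X) {ι : Type*} (s : Finset ι) {u v : ι → H}
    {K : ℝ} (hK : 0 ≤ K)
    (hu : ∀ x, ∑ i ∈ s, ‖⟪u i, x⟫_ℂ‖ ^ 2 ≤ K * ‖x‖ ^ 2)
    (hv : ∀ x, ∑ i ∈ s, ‖⟪v i, x⟫_ℂ‖ ^ 2 ≤ K * ‖x‖ ^ 2) :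
    ∑ i ∈ s, ∫ t, ‖⟪u i, p t⟫_ℂ‖ * ‖⟪q t, v i⟫_ℂ‖ ∂μ ≤ K * ∫ t, ‖p t‖ * ‖q t‖ ∂μ := by
  have hi : ∀ i, Integrable (fun t => ‖⟪u i, p t⟫_ℂ‖ * ‖⟪q t, v i⟫_ℂ‖) μ := fun i => by
    simpa only [norm_mul] using (h.integrable_inner (u i) (v i)).norm
  rw [← integral_finsetSum _ fun i _ => hi i, ← integral_const_mul]
  exact integral_mono (integrable_finsetSum _ fun i _ => hi i) (h.integrable_norm.const_mul K)
    fun t => sum_norm_inner_mul_le s hK (hu _) (hv _)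

theorem sum_norm_inner_apply_le (h : IsNuclear μ p q X) {ι : Type*} (s : Finset ι) {u v : ι → H}
    {K : ℝ} (hK : 0 ≤ K)
    (hu : ∀ x, ∑ i ∈ s, ‖⟪u i, x⟫_ℂ‖ ^ 2 ≤ K * ‖x‖ ^ 2)
    (hv : ∀ x, ∑ i ∈ s, ‖⟪v i, x⟫_ℂ‖ ^ 2 ≤ K * ‖x‖ ^ 2) :
    ∑ i ∈ s, ‖⟪u i, X (v i)⟫_ℂ‖ ≤ K * ∫ t, ‖p t‖ * ‖q t‖ ∂μ :=
  (Finset.sum_le_sum fun _ _ => h.norm_inner_apply_le _ _).trans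
    (h.sum_integral_norm_le s hK hu hv)

variable [CompleteSpace H]

/-- For each `t` the sum over the basis is Parseval's identity for `p t` and `W† (q t)`.
Cauchy–Schwarz and Bessel dominate it by `‖W‖ ‖p t‖ ‖q t‖`, which lets the countable sum pass
through the integral. -/
theorem hasSum_trace (h : IsNuclear μ p q X) [Countable (basisIndex H)] (W : H →L[ℂ] H) :
    HasSum (fun i => ⟪basis H i, (X ∘L W) (basis H i)⟫_ℂ) (∫ t, ⟪q t, W (p t)⟫_ℂ ∂μ) := by
  set e := basis H
  have hint : ∀ i, Integrable (fun t => ⟪e i, p t⟫_ℂ * ⟪q t, W (e i)⟫_ℂ) μ :=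
    fun i => h.integrable_inner _ _
  have hsum : Summable fun i => ∫ t, ‖⟪e i, p t⟫_ℂ * ⟪q t, W (e i)⟫_ℂ‖ ∂μ := by
    refine summable_of_sum_le (c := ∫ t, ‖W‖ * (‖p t‖ * ‖q t‖) ∂μ)
      (fun i => integral_nonneg fun t => norm_nonneg _) fun s => ?_
    rw [← integral_finsetSum _ fun i _ => (hint i).norm]
    refine integral_mono (integrable_finsetSum _ fun i _ => (hint i).norm)
      (h.integrable_norm.const_mul _) fun t => ?_
    simp only [norm_mul]
    simp_rw [← ContinuousLinearMap.adjoint_inner_left W]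
    refine (sum_norm_inner_mul_le_of_orthonormal s e.orthonormal _ _).trans ?_
    have h1 : ‖ContinuousLinearMap.adjoint W (q t)‖ ≤ ‖W‖ * ‖q t‖ := by
      simpa using (ContinuousLinearMap.adjoint W).le_opNorm (q t)
    calc _ ≤ ‖p t‖ * (‖W‖ * ‖q t‖) := by gcongr
      _ = _ := by ring
  have h1 := hasSum_integral_of_summable_integral_norm hint hsum
  have h2 : ∀ t, ∑' i, ⟪e i, p t⟫_ℂ * ⟪q t, W (e i)⟫_ℂ = ⟪q t, W (p t)⟫_ℂ := fun t => by
    rw [← ContinuousLinearMap.adjoint_inner_left, ← e.tsum_inner_mul_inner]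
    refine tsum_congr fun i => ?_
    rw [ContinuousLinearMap.adjoint_inner_left, mul_comm]
  simp_rw [h2] at h1
  refine h1.congr_fun fun i => ?_
  rw [ContinuousLinearMap.comp_apply, h.inner_apply]

theorem trace_comp (h : IsNuclear μ p q X) [Countable (basisIndex H)] (W : H →L[ℂ] H) :
    trace (X ∘L W) = ∫ t, ⟪q t, W (p t)⟫_ℂ ∂μ :=
  (h.hasSum_trace W).tsum_eq

end IsNuclear

variable [CompleteSpace H]

/-- With `U` from the polar decomposition, `⟪e, |X| e⟫ = ⟪U e, X e⟫`. Asking for the bound at every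
contraction removes `|X|` from the hypothesis and makes it stable under sums of operators. -/
theorem traceNorm_le_of_sum_le {X : H →L[ℂ] H} {M : ℝ}
    (h : ∀ (U : H →L[ℂ] H), (∀ x, ‖U x‖ ≤ ‖x‖) → ∀ s : Finset (basisIndex H),
      ∑ i ∈ s, ‖⟪U (basis H i), X (basis H i)⟫_ℂ‖ ≤ M) :
    traceNorm X ≤ ENNReal.ofReal M := by
  obtain ⟨U, hU1, -, hU3⟩ := exists_polar X
  unfold traceNorm
  rw [ENNReal.tsum_eq_iSup_sum]
  refine iSup_le fun s => ?_
  rw [← ENNReal.ofReal_sum_of_nonneg fun i _ => ?_]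
  · refine ENNReal.ofReal_le_ofReal ((Finset.sum_le_sum fun i _ => ?_).trans (h U hU1 s))
    rw [← hU3, ContinuousLinearMap.adjoint_inner_right]
    exact Complex.re_le_norm _
  · exact ((ContinuousLinearMap.nonneg_iff_isPositive _).1 (CFC.abs_nonneg X)).re_inner_nonneg_right
      (basis H i)

theorem sum_norm_inner_map_sq_le {U : H →L[ℂ] H} (hU : ∀ x, ‖U x‖ ≤ ‖x‖) {ι : Type*} (s : Finset ι)
    {e : ι → H} (he : Orthonormal ℂ e) (x : H) :
    ∑ i ∈ s, ‖⟪U (e i), x⟫_ℂ‖ ^ 2 ≤ 1 * ‖x‖ ^ 2 := by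
  simp_rw [← ContinuousLinearMap.adjoint_inner_right U, one_mul]
  refine (he.sum_inner_products_le _).trans ?_
  have hUn : ‖ContinuousLinearMap.adjoint U‖ ≤ 1 := by
    rw [LinearIsometryEquiv.norm_map]
    exact U.opNorm_le_bound zero_le_one (by simpa using hU)
  gcongr
  simpa using ContinuousLinearMap.le_of_opNorm_le _ hUn x

theorem IsNuclear.sum_norm_inner_basis_le {T : Type*} [MeasurableSpace T] {μ : Measure T}
    {p q : T → H} {X : H →L[ℂ] H} (h : IsNuclear μ p q X) {U : H →L[ℂ] H}
    (hU : ∀ x, ‖U x‖ ≤ ‖x‖) (s : Finset (basisIndex H)) :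
    ∑ i ∈ s, ‖⟪U (basis H i), X (basis H i)⟫_ℂ‖ ≤ ∫ t, ‖p t‖ * ‖q t‖ ∂μ := by
  simpa using h.sum_norm_inner_apply_le s zero_le_one
    (fun x => sum_norm_inner_map_sq_le hU s (basis H).orthonormal x)
    (fun x => by simpa using (basis H).orthonormal.sum_inner_products_le (s := s) x)

theorem IsNuclear.traceNorm_le {T : Type*} [MeasurableSpace T] {μ : Measure T}
    {p q : T → H} {X : H →L[ℂ] H} (h : IsNuclear μ p q X) :
    traceNorm X ≤ ENNReal.ofReal (∫ t, ‖p t‖ * ‖q t‖ ∂μ) :=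
  traceNorm_le_of_sum_le fun _ hU s => h.sum_norm_inner_basis_le hU s

theorem IsNuclear.isTraceClass {T : Type*} [MeasurableSpace T] {μ : Measure T}
    {p q : T → H} {X : H →L[ℂ] H} (h : IsNuclear μ p q X) : IsTraceClass X :=
  h.traceNorm_le.trans_lt ENNReal.ofReal_lt_top

/-- The counting measure on the index set of the fixed Hilbert basis. -/
noncomputable abbrev basisCount (H : Type*) [NormedAddCommGroup H] [InnerProductSpace ℂ H]
    [CompleteSpace H] : @Measure (basisIndex H) ⊤ :=
  @Measure.count (basisIndex H) ⊤

/-- A trace-class operator `X = U |X|` is the sum of the operators `|U √|X| e i⟩⟨√|X| e i|`. -/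
theorem IsTraceClass.exists_isNuclear {X : H →L[ℂ] H} [Countable (basisIndex H)]
    (h : IsTraceClass X) :
    ∃ p q : basisIndex H → H, @IsNuclear H _ _ _ ⊤ (basisCount H) p q X ∧
      @integral _ _ _ _ ⊤ (basisCount H) (fun t => ‖p t‖ * ‖q t‖) ≤ (traceNorm X).toReal := by
  -- In the discrete σ-algebra every function is measurable, and integrals against the counting
  -- measure are sums over the basis.
  let _ : MeasurableSpace (basisIndex H) := ⊤
  obtain ⟨U, hU1, hU2, -⟩ := exists_polar X
  set A : H →L[ℂ] H := CFC.sqrt (CFC.abs X) with hA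
  set e := basis H with he
  have hAA : ∀ x, A (A x) = CFC.abs X x := fun x => by
    rw [← mul_apply_eq_comp, CFC.sqrt_mul_sqrt_self _ (CFC.abs_nonneg X)]
  have hsa : ContinuousLinearMap.adjoint A = A := (CFC.sqrt_nonneg _).isSelfAdjoint.star_eq
  have hAi : ∀ x y, ⟪x, A y⟫_ℂ = ⟪A x, y⟫_ℂ := fun x y => by
    rw [← ContinuousLinearMap.adjoint_inner_right, hsa]
  have hsq : ∀ i, (⟪e i, CFC.abs X (e i)⟫_ℂ).re = ‖A (e i)‖ ^ 2 := fun i => by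
    rw [← hAA, hAi, inner_self_eq_norm_sq_to_K]; norm_cast
  have htn : traceNorm X = ∑' i, ENNReal.ofReal (‖A (e i)‖ ^ 2) :=
    tsum_congr fun i => by rw [hsq]
  have hne : ∑' i, ENNReal.ofReal (‖A (e i)‖ ^ 2) ≠ ∞ := htn ▸ h.ne
  have hsumm : Summable fun i => ‖A (e i)‖ ^ 2 := by
    have := ENNReal.summable_toReal hne
    exact this.congr fun i => ENNReal.toReal_ofReal (by positivity)
  have hle : ∀ i, ‖U (A (e i))‖ * ‖A (e i)‖ ≤ ‖A (e i)‖ ^ 2 := fun i => by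
    rw [sq]; gcongr; exact hU1 _
  have hint2 : Integrable (fun i => ‖A (e i)‖ ^ 2) (basisCount H) := by
    rw [integrable_count_iff]; exact hsumm.abs
  have hint : Integrable (fun i => ‖U (A (e i))‖ * ‖A (e i)‖) (basisCount H) :=
    hint2.mono' .of_discrete (.of_forall fun i => by
      rw [Real.norm_of_nonneg (by positivity)]; exact hle i)
  have hnuc : ∀ φ ψ, Integrable (fun i => ⟪φ, U (A (e i))⟫_ℂ * ⟪A (e i), ψ⟫_ℂ) (basisCount H) := by
    intro φ ψ
    refine (hint.const_mul (‖φ‖ * ‖ψ‖)).mono' .of_discrete (.of_forall fun t => ?_)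
    rw [norm_mul]
    calc _ ≤ (‖φ‖ * ‖U (A (e t))‖) * (‖A (e t)‖ * ‖ψ‖) := by
          gcongr <;> exact norm_inner_le_norm _ _
      _ = _ := by ring
  refine ⟨fun i => U (A (e i)), fun i => A (e i), ⟨.of_discrete, .of_discrete, hint, ?_⟩, ?_⟩
  · intro φ ψ
    rw [integral_countable (hnuc φ ψ), ← hU2, ← hAA, ← ContinuousLinearMap.adjoint_inner_left,
      hAi, ← e.tsum_inner_mul_inner]
    refine tsum_congr fun i => ?_
    rw [← hAi, ContinuousLinearMap.adjoint_inner_left, ← hAi]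
    simp [Measure.real]
  · refine (integral_mono hint hint2 hle).trans ?_
    rw [integral_countable hint2, htn, ENNReal.tsum_toReal_eq (fun i => ENNReal.ofReal_ne_top)]
    refine le_of_eq (tsum_congr fun i => ?_)
    rw [ENNReal.toReal_ofReal (by positivity)]
    simp [Measure.real]

/-- The absolute value of a sum is not controlled termwise, but the sums in `traceNorm_le_of_sum_le`
are. -/
theorem isTraceClass_sum [Countable (basisIndex H)] {ι : Type*} (s : Finset ι) {X : ι → H →L[ℂ] H}
    (h : ∀ j ∈ s, IsTraceClass (X j)) : IsTraceClass (∑ j ∈ s, X j) := by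
  refine (traceNorm_le_of_sum_le (M := ∑ j ∈ s, (traceNorm (X j)).toReal)
    fun U hU b => ?_).trans_lt ENNReal.ofReal_lt_top
  calc _ ≤ ∑ i ∈ b, ∑ j ∈ s, ‖⟪U (basis H i), X j (basis H i)⟫_ℂ‖ := by
        refine Finset.sum_le_sum fun i _ => ?_
        rw [sum_apply, inner_sum]
        exact norm_sum_le _ _
    _ ≤ _ := by
        rw [Finset.sum_comm]
        refine Finset.sum_le_sum fun j hj => ?_
        obtain ⟨p, q, h1, h2⟩ := (h j hj).exists_isNuclear
        exact (@IsNuclear.sum_norm_inner_basis_le H _ _ _ _ ⊤ _ _ _ _ h1 _ hU b).trans h2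

theorem IsTraceClass.summable_trace_comp [Countable (basisIndex H)] {X : H →L[ℂ] H}
    (h : IsTraceClass X) (W : H →L[ℂ] H) :
    Summable (fun i => ⟪basis H i, (X ∘L W) (basis H i)⟫_ℂ) := by
  obtain ⟨p, q, h1, -⟩ := h.exists_isNuclear
  exact (@IsNuclear.hasSum_trace H _ _ _ ⊤ _ _ _ _ _ h1 _ W).summable

theorem trace_sum_comp [Countable (basisIndex H)] {ι : Type*} (s : Finset ι) {X : ι → H →L[ℂ] H}
    (h : ∀ j ∈ s, IsTraceClass (X j)) (W : H →L[ℂ] H) :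
    trace ((∑ j ∈ s, X j) ∘L W) = ∑ j ∈ s, trace (X j ∘L W) := by
  unfold trace
  rw [← Summable.tsum_finsetSum fun j hj => (h j hj).summable_trace_comp W]
  refine tsum_congr fun i => ?_
  rw [ContinuousLinearMap.comp_apply, sum_apply, inner_sum]
  rfl

/-- The trace norm controls the matrix elements of a trace-class operator along finite families
that satisfy Bessel's inequality. -/
theorem IsTraceClass.sum_norm_inner_le [Countable (basisIndex H)] {X : H →L[ℂ] H}
    (h : IsTraceClass X) {ι : Type*} (s : Finset ι) {u v : ι → H} {K : ℝ} (hK : 0 ≤ K)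
    (hu : ∀ x, ∑ i ∈ s, ‖⟪u i, x⟫_ℂ‖ ^ 2 ≤ K * ‖x‖ ^ 2)
    (hv : ∀ x, ∑ i ∈ s, ‖⟪v i, x⟫_ℂ‖ ^ 2 ≤ K * ‖x‖ ^ 2) :
    ∑ i ∈ s, ‖⟪u i, X (v i)⟫_ℂ‖ ≤ K * (traceNorm X).toReal := by
  obtain ⟨p, q, h1, h2⟩ := h.exists_isNuclear
  exact (@IsNuclear.sum_norm_inner_apply_le H _ _ _ ⊤ _ _ _ _ h1 _ s u v K hK hu hv).trans
    (mul_le_mul_of_nonneg_left h2 hK)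

omit [CompleteSpace H] in
theorem continuous_rankOne :
    Continuous fun z : H × H => (InnerProductSpace.rankOne ℂ z.1 z.2 : H →L[ℂ] H) := by
  have h1 : Continuous fun z : H × H =>
      ContinuousLinearMap.smulRightL ℂ H H (innerSL ℂ z.2) := by fun_prop
  exact h1.clm_apply continuous_fst

/-- The integral of a family of rank-one operators. -/
theorem exists_isNuclear {T : Type*} [MeasurableSpace T] {μ : Measure T} {p q : T → H}
    (hp : AEStronglyMeasurable p μ) (hq : AEStronglyMeasurable q μ)
    (hpq : Integrable (fun t => ‖p t‖ * ‖q t‖) μ) : ∃ X : H →L[ℂ] H, IsNuclear μ p q X := by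
  have hint : Integrable (fun t => InnerProductSpace.rankOne ℂ (p t) (q t)) μ := by
    refine hpq.mono' ?_ (.of_forall fun t => by simp)
    have key : ∀ g : H × H → H →L[ℂ] H, Continuous g →
        AEStronglyMeasurable (fun t => g (p t, q t)) μ :=
      fun g hg => hg.comp_aestronglyMeasurable (hp.prodMk hq)
    exact key (fun z => InnerProductSpace.rankOne ℂ z.1 z.2) continuous_rankOne
  refine ⟨∫ t, InnerProductSpace.rankOne ℂ (p t) (q t) ∂μ, hp, hq, hpq, fun φ ψ => ?_⟩
  rw [ContinuousLinearMap.integral_apply hint, ← innerSL_apply_apply ℂ,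
    ← ContinuousLinearMap.integral_comp_comm _ (hint.apply_continuousLinearMap ψ)]
  refine integral_congr_ae (.of_forall fun t => ?_)
  simp [mul_comm]

omit [CompleteSpace H] in
theorem isNuclear_rankOne (f g : H) :
    IsNuclear (Measure.dirac ()) (fun _ => f) (fun _ => g) (InnerProductSpace.rankOne ℂ f g) where
  aesm_left := aestronglyMeasurable_const
  aesm_right := aestronglyMeasurable_const
  integrable_norm := integrable_const _
  inner_apply φ ψ := by simp [mul_comm]

end Nuclear

/-! ### Gaussian vectors and their Weyl matrix elements -/

section Gaussian

variable {n : ℕ}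

/-- The Gaussian integral `∫ exp (- b |x| ^ 2)` over `ℝⁿ`. -/
noncomputable def gaussConst (n : ℕ) (b : ℝ) : ℝ := (Real.pi / b) ^ ((n : ℝ) / 2)

theorem gaussConst_pos {b : ℝ} (hb : 0 < b) : 0 < gaussConst n b :=
  Real.rpow_pos_of_pos (div_pos Real.pi_pos hb) _

theorem cexp_sum_quadratic (b : ℝ) (c d : Fin n → ℂ) (x : Fin n → ℝ) :
    Complex.exp (∑ i, (-(b : ℂ) * (x i : ℂ) ^ 2 + c i * x i + d i)) =
      Complex.exp (-(b : ℂ) * ∑ i, (x i : ℂ) ^ 2 + ∑ i, c i * x i) * Complex.exp (∑ i, d i) := by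
  rw [← Complex.exp_add, Finset.sum_add_distrib, Finset.sum_add_distrib, Finset.mul_sum]

theorem integrable_cexp_sum_quadratic {b : ℝ} (hb : 0 < b) (c d : Fin n → ℂ) :
    Integrable fun x : Fin n → ℝ =>
      Complex.exp (∑ i, (-(b : ℂ) * (x i : ℂ) ^ 2 + c i * x i + d i)) := by
  simp_rw [cexp_sum_quadratic]
  exact (GaussianFourier.integrable_cexp_neg_mul_sum_add (by simpa using hb) c).mul_const _

theorem integral_cexp_sum_quadratic {b : ℝ} (hb : 0 < b) (c d : Fin n → ℂ) :
    ∫ x : Fin n → ℝ, Complex.exp (∑ i, (-(b : ℂ) * (x i : ℂ) ^ 2 + c i * x i + d i)) =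
      gaussConst n b * Complex.exp (∑ i, (c i ^ 2 / (4 * b) + d i)) := by
  simp_rw [cexp_sum_quadratic]
  rw [integral_mul_const, GaussianFourier.integral_cexp_neg_mul_sum_add (by simpa using hb) c,
    Finset.sum_add_distrib, Complex.exp_add, gaussConst,
    Complex.ofReal_cpow (div_pos Real.pi_pos hb).le, Finset.sum_div, mul_assoc]
  simp

/-- The Gaussian `exp (- a |x - w| ^ 2 + i ξ · x)`. -/
noncomputable def gaussFun (a : ℝ) (w ξ x : Fin n → ℝ) : ℂ :=
  Complex.exp (∑ i, (-(a : ℂ) * ((x i : ℂ) - w i) ^ 2 + Complex.I * ξ i * x i))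

theorem continuous_gaussFun (a : ℝ) (w ξ : Fin n → ℝ) : Continuous (gaussFun a w ξ) := by
  unfold gaussFun; fun_prop

theorem conj_gaussFun (a : ℝ) (w ξ x : Fin n → ℝ) : (starRingEnd ℂ) (gaussFun a w ξ x) =
    Complex.exp (∑ i, (-(a : ℂ) * ((x i : ℂ) - w i) ^ 2 - Complex.I * ξ i * x i)) := by
  rw [gaussFun, ← Complex.exp_conj, map_sum]
  congr 1
  refine Finset.sum_congr rfl fun i _ => ?_
  simp [sub_eq_add_neg]

theorem memLp_gaussFun {a : ℝ} (ha : 0 < a) (w ξ : Fin n → ℝ) :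
    MemLp (gaussFun a w ξ) 2 volume := by
  rw [memLp_two_iff_integrable_sq_norm (continuous_gaussFun a w ξ).aestronglyMeasurable]
  refine ((integrable_cexp_sum_quadratic (b := 2 * a) (by positivity)
    (fun i => 4 * a * w i) (fun i => -2 * a * w i ^ 2)).norm).congr (.of_forall fun x => ?_)
  have : ((‖gaussFun a w ξ x‖ : ℂ)) ^ 2 = Complex.exp (∑ i, (-((2 * a : ℝ) : ℂ) * (x i : ℂ) ^ 2 +
      4 * a * w i * x i + -2 * a * w i ^ 2)) := by
    rw [← Complex.mul_conj', conj_gaussFun, gaussFun, ← Complex.exp_add, ← Finset.sum_add_distrib]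
    congr 1
    refine Finset.sum_congr rfl fun i _ => ?_
    push_cast; ring
  beta_reduce
  rw [← this]
  simp

/-- The Gaussian `exp (- a |x - w| ^ 2 + i ξ · x)` as a vector of `L²(ℝⁿ)`. -/
noncomputable def gauss {a : ℝ} (ha : 0 < a) (w ξ : Fin n → ℝ) : Hilb n :=
  (memLp_gaussFun ha w ξ).toLp

theorem gauss_ae {a : ℝ} (ha : 0 < a) (w ξ : Fin n → ℝ) :
    gauss ha w ξ =ᵐ[volume] gaussFun a w ξ :=
  MemLp.coeFn_toLp _

theorem weyl_zero (ψ : Hilb n) : weyl 0 ψ = ψ := by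
  refine Lp.ext ((weyl_apply_ae 0 ψ).trans (.of_forall fun x => ?_))
  simp [weylFun, weylPhase]

theorem norm_weyl_apply (k : Phase n) (ψ : Hilb n) : ‖weyl k ψ‖ = ‖ψ‖ :=
  (weylIsometry k).norm_map ψ

theorem inner_weyl (φ ψ : Hilb n) (k : Phase n) :
    ⟪φ, weyl k ψ⟫_ℂ = ∫ x, (starRingEnd ℂ) (φ x) * (weylPhase k x * ψ (x + k.2)) := by
  rw [L2.inner_def]
  refine integral_congr_ae ?_
  filter_upwards [weyl_apply_ae k ψ] with x hx
  rw [hx, RCLike.inner_apply, mul_comm, weylFun]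

/-- Matrix elements of the Weyl operators between Gaussians. -/
theorem inner_gauss_weyl_gauss {a : ℝ} (ha : 0 < a) (w' η w ξ : Fin n → ℝ) (k : Phase n) :
    ⟪gauss ha w' η, weyl k (gauss ha w ξ)⟫_ℂ = gaussConst n (2 * a) *
      Complex.exp (∑ i, (-(a / 2 : ℂ) * (w' i - w i + k.2 i) ^ 2 -
        (k.1 i + ξ i - η i) ^ 2 / (8 * a) +
        Complex.I / 2 * ((w i + w' i) * (k.1 i + ξ i - η i) + k.2 i * (ξ i + η i)))) := by
  have ha' : (a : ℂ) ≠ 0 := by exact_mod_cast ha.ne'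
  rw [inner_weyl]
  have h : ∀ᵐ x : Fin n → ℝ, (starRingEnd ℂ) (gauss ha w' η x) *
      (weylPhase k x * gauss ha w ξ (x + k.2)) =
      Complex.exp (∑ i, (-((2 * a : ℝ) : ℂ) * (x i : ℂ) ^ 2 +
        (2 * a * (w' i + w i - k.2 i) + Complex.I * (k.1 i + ξ i - η i)) * x i +
        (-a * w' i ^ 2 - a * (k.2 i - w i) ^ 2 +
          Complex.I * (k.1 i * k.2 i / 2 + ξ i * k.2 i)))) := by
    have h1 := (measurePreserving_add_right (volume : Measure (Fin n → ℝ))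
      k.2).quasiMeasurePreserving.ae_eq_comp (gauss_ae ha w ξ)
    filter_upwards [gauss_ae ha w' η, h1] with x hx1 hx2
    simp only [Function.comp_apply] at hx2
    rw [hx1, hx2, conj_gaussFun, gaussFun, weylPhase, ← Complex.exp_add, ← Complex.exp_add]
    congr 1
    simp only [dotProduct]
    push_cast
    rw [Finset.sum_div, ← Finset.sum_add_distrib, Finset.mul_sum, ← Finset.sum_add_distrib,
      ← Finset.sum_add_distrib]
    refine Finset.sum_congr rfl fun i _ => ?_
    simp only [Pi.add_apply]
    push_cast
    ring
  rw [integral_congr_ae h, integral_cexp_sum_quadratic (by positivity)]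
  congr 2
  refine Finset.sum_congr rfl fun i _ => ?_
  push_cast
  field_simp
  ring_nf
  simp only [Complex.I_sq]
  ring

theorem inner_gauss_gauss {a : ℝ} (ha : 0 < a) (w' η w ξ : Fin n → ℝ) :
    ⟪gauss ha w' η, gauss ha w ξ⟫_ℂ = gaussConst n (2 * a) *
      Complex.exp (∑ i, (-(a / 2 : ℂ) * (w' i - w i) ^ 2 - (ξ i - η i) ^ 2 / (8 * a) +
        Complex.I / 2 * ((w i + w' i) * (ξ i - η i)))) := by
  have := inner_gauss_weyl_gauss ha w' η w ξ 0
  rw [weyl_zero] at this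
  simpa using this

theorem norm_inner_gauss_gauss {a : ℝ} (ha : 0 < a) (w' η w ξ : Fin n → ℝ) :
    ‖⟪gauss ha w' η, gauss ha w ξ⟫_ℂ‖ = gaussConst n (2 * a) *
      Real.exp (-(a / 2) * (∑ i, (w' i - w i) ^ 2) - (∑ i, (ξ i - η i) ^ 2) / (8 * a)) := by
  rw [inner_gauss_gauss, norm_mul, Complex.norm_real,
    Real.norm_of_nonneg (gaussConst_pos (by positivity)).le, Complex.norm_exp, Complex.re_sum,
    Finset.mul_sum, Finset.sum_div, ← Finset.sum_sub_distrib]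
  congr 2
  refine Finset.sum_congr rfl fun i _ => ?_
  have : (-(a / 2 : ℂ) * (w' i - w i) ^ 2 - (ξ i - η i) ^ 2 / (8 * a) +
        Complex.I / 2 * ((w i + w' i) * (ξ i - η i))) =
      ((-(a / 2) * (w' i - w i) ^ 2 - (ξ i - η i) ^ 2 / (8 * a) : ℝ) : ℂ) +
      (((w i + w' i) * (ξ i - η i) / 2 : ℝ) : ℂ) * Complex.I := by
    push_cast; ring
  rw [this, Complex.add_re, Complex.ofReal_re, Complex.re_ofReal_mul, Complex.I_re, mul_zero,
    add_zero]

theorem norm_gauss_sq {a : ℝ} (ha : 0 < a) (w ξ : Fin n → ℝ) :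
    ‖gauss ha w ξ‖ ^ 2 = gaussConst n (2 * a) := by
  have := norm_inner_gauss_gauss ha w ξ w ξ
  rw [inner_self_eq_norm_sq_to_K] at this
  simpa using this

/-- All these vectors have the same norm, so their distances are read off from the explicit,
continuous inner product. -/
theorem continuous_gauss {a : ℝ} (ha : 0 < a) (ξ : Fin n → ℝ) :
    Continuous fun w : Fin n → ℝ => gauss ha w ξ := by
  rw [continuous_iff_continuousAt]
  intro w₀
  rw [ContinuousAt, tendsto_iff_norm_sub_tendsto_zero]
  have h : ∀ w, ‖gauss ha w ξ - gauss ha w₀ ξ‖ =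
      √(2 * gaussConst n (2 * a) - 2 * RCLike.re ⟪gauss ha w ξ, gauss ha w₀ ξ⟫_ℂ) := by
    intro w
    rw [← Real.sqrt_sq (norm_nonneg (gauss ha w ξ - gauss ha w₀ ξ)), norm_sub_sq (𝕜 := ℂ),
      norm_gauss_sq, norm_gauss_sq]
    congr 1
    ring
  have hc : Continuous fun w : Fin n → ℝ => ‖gauss ha w ξ - gauss ha w₀ ξ‖ := by
    simp_rw [h, inner_gauss_gauss]
    refine Real.continuous_sqrt.comp (continuous_const.sub (continuous_const.mul
      (RCLike.continuous_re.comp ?_)))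
    fun_prop
  simpa using hc.tendsto w₀

end Gaussian

/-! ### The explicit dilatation of a Gaussian rank-one operator -/

section Dilatation

variable {n : ℕ}

/-- Orthonormal vectors are at distance `√2`, so the balls of radius `1/2` around them are disjoint.
-/
theorem countable_of_hilbertBasis {H ι : Type*} [NormedAddCommGroup H]
    [InnerProductSpace ℂ H] [TopologicalSpace.SeparableSpace H] (e : HilbertBasis ι ℂ H) :
    Countable ι := by
  have hd : Set.PairwiseDisjoint (Set.univ : Set ι) fun i => Metric.ball (e i) (1 / 2) := by
    intro i _ j _ hij
    refine Metric.ball_disjoint_ball ?_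
    have h1 : ‖e i - e j‖ ^ 2 = 2 := by
      rw [norm_sub_sq (𝕜 := ℂ), e.orthonormal.1, e.orthonormal.1, e.orthonormal.2 hij]
      norm_num
    rw [dist_eq_norm]
    nlinarith [norm_nonneg (e i - e j)]
  exact Set.countable_univ_iff.1 (hd.countable_of_isOpen (fun _ _ => Metric.isOpen_ball)
    fun i _ => ⟨e i, Metric.mem_ball_self (by norm_num)⟩)

instance countable_basisIndex : Countable (basisIndex (Hilb n)) :=
  have : Fact ((2 : ℝ≥0∞) ≠ ∞) := ⟨by simp⟩
  countable_of_hilbertBasis (basis (Hilb n))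

/-- The Gaussian weight `K exp (- d |z| ^ 2)`. -/
noncomputable def gaussWeight (K d : ℝ) (z : Fin n → ℝ) : ℂ :=
  K * Complex.exp (∑ i, -(d : ℂ) * (z i : ℂ) ^ 2)

theorem continuous_gaussWeight (K d : ℝ) : Continuous (gaussWeight K d : (Fin n → ℝ) → ℂ) := by
  unfold gaussWeight; fun_prop

theorem integrable_gaussWeight (K : ℝ) {d : ℝ} (hd : 0 < d) :
    Integrable (gaussWeight K d : (Fin n → ℝ) → ℂ) := by
  have := (integrable_cexp_sum_quadratic (n := n) hd 0 0).const_mul (K : ℂ)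
  refine this.congr (.of_forall fun z => ?_)
  simp [gaussWeight]

/-- The mixture `∫ K exp (- d |z| ^ 2) |gauss z η⟩⟨gauss (e z) η'| dz` of rank-one operators. -/
theorem exists_gaussMixture {a d K : ℝ} (ha : 0 < a) (hd : 0 < d) (e : ℝ)
    (η η' : Fin n → ℝ) : ∃ Y : Hilb n →L[ℂ] Hilb n,
      IsNuclear volume (fun z => gauss ha z η)
        (fun z => gaussWeight K d z • gauss ha (e • z) η') Y := by
  refine exists_isNuclear (continuous_gauss ha η).aestronglyMeasurable
    ((continuous_gaussWeight K d).smul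
      ((continuous_gauss ha η').comp (continuous_const_smul e))).aestronglyMeasurable ?_
  have h : ∀ w ξ : Fin n → ℝ, ‖gauss ha w ξ‖ = √(gaussConst n (2 * a)) := fun w ξ => by
    rw [← norm_gauss_sq ha w ξ, Real.sqrt_sq (norm_nonneg _)]
  simp_rw [norm_smul, h]
  exact (((integrable_gaussWeight K hd).norm).mul_const _).const_mul _

theorem conj_gaussWeight (K d : ℝ) (z : Fin n → ℝ) :
    (starRingEnd ℂ) (gaussWeight K d z) = gaussWeight K d z := by
  have : (∑ i, -(d : ℂ) * (z i : ℂ) ^ 2) = ((∑ i, -d * z i ^ 2 : ℝ) : ℂ) := by push_cast; rfl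
  rw [gaussWeight, this, map_mul, ← Complex.exp_conj, Complex.conj_ofReal, Complex.conj_ofReal]

theorem charFn_rankOne (f g : Hilb n) (k : Phase n) :
    charFn (InnerProductSpace.rankOne ℂ f g) k = ⟪g, weyl k f⟫_ℂ := by
  rw [charFn, (isNuclear_rankOne f g).trace_comp, integral_dirac]

/-- The characteristic function of a Gaussian mixture is the dilatation of that of a
Gaussian rank-one operator. -/
theorem isDilatation_gaussMixture {l a d e c s : ℝ} (hl : l ≠ 0) (ha : 0 < a) (hd : 0 < d)
    (hcs : c + s = 1 / l) (hcs' : c - s = l) (he : (e - 1) * (1 + e) = 0)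
    (hA : (a * (e - 1)) ^ 2 / (4 * (d + a / 2 * (e - 1) ^ 2)) - a / 2 = -(l ^ 2 / 4))
    (hB : ((1 + e) / 2) ^ 2 / (4 * (d + a / 2 * (e - 1) ^ 2)) + 1 / (8 * a) = l ^ 2 / 4)
    (ξ : Fin n → ℝ) {Y : Hilb n →L[ℂ] Hilb n}
    (hY : IsNuclear volume (fun z => gauss ha z (c • ξ))
      (fun z => gaussWeight (gaussConst n 1 / (gaussConst n (2 * a) *
        gaussConst n (d + a / 2 * (e - 1) ^ 2))) d z • gauss ha (e • z) (-(s • ξ))) Y) :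
    IsDilatation l (InnerProductSpace.rankOne ℂ (gauss one_half_pos 0 ξ) (gauss one_half_pos 0 0))
      Y := by
  intro k
  set b := d + a / 2 * (e - 1) ^ 2 with hb
  have hb0 : 0 < b := by positivity
  rw [charFn_rankOne, inner_gauss_weyl_gauss, charFn, hY.trace_comp]
  simp_rw [inner_smul_left, conj_gaussWeight, inner_gauss_weyl_gauss, gaussWeight]
  have h1 : ∀ z : Fin n → ℝ, (((gaussConst n 1 / (gaussConst n (2 * a) * gaussConst n b) : ℝ) : ℂ) *
      Complex.exp (∑ i, -(d : ℂ) * (z i : ℂ) ^ 2)) * (gaussConst n (2 * a) *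
      Complex.exp (∑ i, (-(a / 2 : ℂ) * ((e • z) i - z i + k.2 i) ^ 2 -
        (k.1 i + (c • ξ) i - (-(s • ξ)) i) ^ 2 / (8 * a) +
        Complex.I / 2 * ((z i + (e • z) i) * (k.1 i + (c • ξ) i - (-(s • ξ)) i) +
          k.2 i * ((c • ξ) i + (-(s • ξ)) i))))) =
      ((gaussConst n 1 / gaussConst n b : ℝ) : ℂ) *
        Complex.exp (∑ i, (-(b : ℂ) * (z i : ℂ) ^ 2 +
        (-(a * (e - 1)) * k.2 i + Complex.I * ((1 + e) / 2) * (k.1 i + (c + s) * ξ i)) * z i +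
        (-(a / 2) * (k.2 i) ^ 2 - (k.1 i + (c + s) * ξ i) ^ 2 / (8 * a) +
          Complex.I / 2 * (k.2 i * (c - s) * ξ i)))) := by
    intro z
    have hg : (gaussConst n (2 * a) : ℂ) ≠ 0 := by
      exact_mod_cast (gaussConst_pos (by positivity)).ne'
    have hg' : (gaussConst n b : ℂ) ≠ 0 := by exact_mod_cast (gaussConst_pos hb0).ne'
    rw [mul_mul_mul_comm, ← Complex.exp_add, ← Finset.sum_add_distrib]
    congr 1
    · push_cast; field_simp
    · congr 1
      refine Finset.sum_congr rfl fun i _ => ?_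
      simp only [Pi.smul_apply, Pi.neg_apply, smul_eq_mul, hb]
      push_cast
      ring
  simp_rw [h1]
  rw [integral_const_mul, integral_cexp_sum_quadratic hb0]
  have hg' : (gaussConst n b : ℂ) ≠ 0 := by exact_mod_cast (gaussConst_pos hb0).ne'
  have hg1 : gaussConst n (2 * (1 / 2)) = gaussConst n 1 := by norm_num
  rw [hg1, ← mul_assoc]
  congr 1
  · push_cast; field_simp
  congr 1
  refine Finset.sum_congr rfl fun i _ => ?_
  have hcsC : (c : ℂ) + s = 1 / l := by exact_mod_cast hcs
  have hcsC' : (c : ℂ) - s = l := by exact_mod_cast hcs'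
  have heC : ((e : ℂ) - 1) * (1 + e) = 0 := by exact_mod_cast he
  have hAC : ((a : ℂ) * (e - 1)) ^ 2 / (4 * b) - a / 2 = -(l ^ 2 / 4) := by exact_mod_cast hA
  have hBC : ((1 + (e : ℂ)) / 2) ^ 2 / (4 * b) + 1 / (8 * a) = l ^ 2 / 4 := by exact_mod_cast hB
  have hlC : (l : ℂ) ≠ 0 := by exact_mod_cast hl
  rw [hcsC, hcsC']
  simp only [Prod.smul_fst, Prod.smul_snd, Pi.smul_apply, Pi.zero_apply, smul_eq_mul]
  push_cast
  set α : ℂ := (k.1 i : ℂ)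
  set β : ℂ := (k.2 i : ℂ)
  set x : ℂ := (ξ i : ℂ)
  -- Completing the square in `z` would leave a cross term in `β (α + x / l)`. Its coefficient
  -- contains `(e - 1) (1 + e) = 0`.
  have hsq : (-(a * (e - 1)) * β + Complex.I * ((1 + e) / 2) * (α + 1 / l * x)) ^ 2 =
      ((a : ℂ) * (e - 1)) ^ 2 * β ^ 2 - ((1 + (e : ℂ)) / 2) ^ 2 * (α + 1 / l * x) ^ 2 := by
    linear_combination (-(a : ℂ) * β * Complex.I * (α + 1 / l * x)) * heC +
      (((1 + (e : ℂ)) / 2) ^ 2 * (α + 1 / l * x) ^ 2) * Complex.I_sq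
  rw [hsq]
  have hlin : l * α + x = l * (α + 1 / l * x) := by field_simp
  rw [zero_add, sub_zero, sub_zero, hlin]
  -- `hA` matches the coefficients of `β²`, and `hB` those of `(α + x / l)²`.
  linear_combination β ^ 2 * hAC - (α + 1 / l * x) ^ 2 * hBC

/-- The dilatation of a Gaussian rank-one operator with momentum shift `ξ` is trace-class, and it
is concentrated at the momenta `c ξ` and `- s ξ`. -/
theorem exists_dilatation_gauss {l : ℝ} (hl0 : l ≠ 0) (hl : l ≠ 1) (hl' : l ≠ -1) (n : ℕ) :
    ∃ (a c s D M : ℝ) (ha : 0 < a), c ≠ 0 ∧ s ≠ 0 ∧ 0 < D ∧ 0 ≤ M ∧ ∀ ξ : Fin n → ℝ,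
      ∃ Y : Hilb n →L[ℂ] Hilb n, IsTraceClass Y ∧
        IsDilatation l
          (InnerProductSpace.rankOne ℂ (gauss one_half_pos 0 ξ) (gauss one_half_pos 0 0)) Y ∧
        ⟪gauss ha 0 (c • ξ), Y (gauss ha 0 (-(s • ξ)))⟫_ℂ = D ∧
        ∀ ζ : Fin n → ℝ, ‖⟪gauss ha 0 (c • ζ), Y (gauss ha 0 (-(s • ζ)))⟫_ℂ‖ ≤
          M * Real.exp (-(c ^ 2 / (8 * a)) * ∑ i, (ξ i - ζ i) ^ 2) := by
  have hl2 : 0 < l ^ 2 := by positivity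
  have hl21 : l ^ 2 ≠ 1 := fun h => by
    have : (l - 1) * (l + 1) = 0 := by linear_combination h
    rcases mul_eq_zero.1 this with h | h
    · exact hl (by linarith)
    · exact hl' (by linarith)
  -- For `l² > 1` the image of the vacuum is a wider Gaussian: squeezed states with the right
  -- momentum variance, mixed over position displacements (`e = 1`). For `l² < 1` it is narrower
  -- than the uncertainty principle allows, and off-diagonal operators `|z⟩⟨-z|` (`e = -1`) produce
  -- it. The values of `a` and `d` solve the two equations.
  obtain ⟨a, d, e, ha, hd, he2, hA, hB⟩ : ∃ a d e : ℝ, 0 < a ∧ 0 < d ∧ e ^ 2 = 1 ∧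
      (a * (e - 1)) ^ 2 / (4 * (d + a / 2 * (e - 1) ^ 2)) - a / 2 = -(l ^ 2 / 4) ∧
      ((1 + e) / 2) ^ 2 / (4 * (d + a / 2 * (e - 1) ^ 2)) + 1 / (8 * a) = l ^ 2 / 4 := by
    rcases lt_or_gt_of_ne hl21 with h | h
    · have h4 : 0 < 1 - l ^ 4 := by nlinarith
      refine ⟨1 / (2 * l ^ 2), l ^ 2 / (1 - l ^ 4), -1, by positivity, by positivity, by norm_num,
        ?_, ?_⟩
      · have : l ^ 2 / (1 - l ^ 4) + 1 / (2 * l ^ 2) / 2 * (-1 - 1) ^ 2 =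
            1 / (l ^ 2 * (1 - l ^ 4)) := by
          field_simp; ring
        rw [this]
        field_simp; ring
      · field_simp; ring
    · have h4 : 0 < l ^ 4 - 1 := by nlinarith
      refine ⟨l ^ 2 / 2, l ^ 2 / (l ^ 4 - 1), 1, by positivity, by positivity, by norm_num, ?_, ?_⟩
      · field_simp; ring
      · rw [sub_self]; field_simp; ring
  have he : (e - 1) * (1 + e) = 0 := by linear_combination he2
  set c := (1 / l + l) / 2 with hc
  set s := (1 / l - l) / 2 with hs
  have hc0 : c ≠ 0 := by
    rw [hc]
    have : (1 / l + l) / 2 = (1 + l ^ 2) / (2 * l) := by field_simp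
    rw [this]; positivity
  have hs0 : s ≠ 0 := by
    rw [hs]
    have : (1 / l - l) / 2 = (1 - l ^ 2) / (2 * l) := by field_simp
    rw [this]
    exact div_ne_zero (sub_ne_zero.2 hl21.symm) (by positivity)
  set b := d + a / 2 * (e - 1) ^ 2 with hb
  have hb0 : 0 < b := by positivity
  set K := gaussConst n 1 / (gaussConst n (2 * a) * gaussConst n b) with hK
  have hG2a : 0 < gaussConst n (2 * a) := gaussConst_pos (by positivity)
  have hK0 : 0 < K := div_pos (gaussConst_pos one_pos) (mul_pos hG2a (gaussConst_pos hb0))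
  refine ⟨a, c, s, K * gaussConst n (2 * a) ^ 2 * gaussConst n (d + a),
    (∫ z : Fin n → ℝ, ‖gaussWeight K d z‖) * gaussConst n (2 * a) ^ 2, ha, hc0, hs0,
    mul_pos (by positivity) (gaussConst_pos (by positivity)), by positivity, fun ξ => ?_⟩
  obtain ⟨Y, hY⟩ := exists_gaussMixture (K := K) ha hd e (c • ξ) (-(s • ξ))
  refine ⟨Y, hY.isTraceClass,
    isDilatation_gaussMixture hl0 ha hd (by rw [hc, hs]; ring) (by rw [hc, hs]; ring) he hA hB ξ hY,
    ?_, fun ζ => ?_⟩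
  · rw [hY.inner_apply]
    -- Both momenta match, so only the position overlaps remain. As `e² = 1`, the exponents add up
    -- to `-(d + a) |z|²`, and the integral does not depend on `ξ`.
    have h1 : ∀ z : Fin n → ℝ, ⟪gauss ha 0 (c • ξ), gauss ha z (c • ξ)⟫_ℂ *
        ⟪gaussWeight K d z • gauss ha (e • z) (-(s • ξ)), gauss ha 0 (-(s • ξ))⟫_ℂ =
        (K * gaussConst n (2 * a) ^ 2 : ℂ) * Complex.exp
          (∑ i, (-((d + a : ℝ) : ℂ) * (z i : ℂ) ^ 2 + (0 : Fin n → ℂ) i * z i +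
            (0 : Fin n → ℂ) i)) := by
      intro z
      rw [inner_smul_left, conj_gaussWeight, inner_gauss_gauss, inner_gauss_gauss, gaussWeight]
      rw [show ∀ g K x y z : ℂ, g * x * (K * y * (g * z)) = K * g ^ 2 * (x * y * z) by
        intros; ring, ← Complex.exp_add, ← Complex.exp_add, ← Finset.sum_add_distrib,
        ← Finset.sum_add_distrib]
      congr 2
      refine Finset.sum_congr rfl fun i _ => ?_
      have heC : (e : ℂ) ^ 2 = 1 := by exact_mod_cast he2
      simp only [Pi.smul_apply, Pi.zero_apply, Pi.neg_apply, smul_eq_mul]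
      push_cast
      linear_combination (-(a / 2 : ℂ) * (z i : ℂ) ^ 2) * heC
    simp_rw [h1]
    rw [integral_const_mul, integral_cexp_sum_quadratic (by positivity)]
    simp
  · refine (hY.norm_inner_apply_le _ _).trans ?_
    rw [mul_assoc, ← integral_mul_const]
    refine integral_mono_of_nonneg (.of_forall fun z => by positivity)
      ((integrable_gaussWeight K hd).norm.mul_const _) (.of_forall fun z => ?_)
    beta_reduce
    rw [inner_smul_left, norm_mul, RCLike.norm_conj, norm_inner_gauss_gauss,
      norm_inner_gauss_gauss]
    -- The left overlap alone supplies the decay in `ξ - ζ`; the exponential in the right overlap is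
    -- bounded by `1`.
    have h1 : Real.exp (-(a / 2) * (∑ i, ((0 : Fin n → ℝ) i - z i) ^ 2) -
        (∑ i, ((c • ξ) i - (c • ζ) i) ^ 2) / (8 * a)) ≤
        Real.exp (-(c ^ 2 / (8 * a)) * ∑ i, (ξ i - ζ i) ^ 2) := by
      refine Real.exp_le_exp.2 ?_
      have h2 : (∑ i, ((c • ξ) i - (c • ζ) i) ^ 2) = c ^ 2 * ∑ i, (ξ i - ζ i) ^ 2 := by
        rw [Finset.mul_sum]
        refine Finset.sum_congr rfl fun i _ => ?_
        simp only [Pi.smul_apply, smul_eq_mul]; ring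
      have h3 : 0 ≤ a / 2 * ∑ i, ((0 : Fin n → ℝ) i - z i) ^ 2 :=
        mul_nonneg (by positivity) (Finset.sum_nonneg fun i _ => sq_nonneg _)
      rw [h2]
      have h4 : c ^ 2 * (∑ i, (ξ i - ζ i) ^ 2) / (8 * a) =
        c ^ 2 / (8 * a) * ∑ i, (ξ i - ζ i) ^ 2 := by ring
      linarith
    have h5 : Real.exp (-(a / 2) * (∑ i, ((e • z) i - (0 : Fin n → ℝ) i) ^ 2) -
        (∑ i, ((-(s • ζ)) i - (-(s • ξ)) i) ^ 2) / (8 * a)) ≤ 1 := by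
      rw [Real.exp_le_one_iff]
      have h3 : 0 ≤ a / 2 * ∑ i, ((e • z) i - (0 : Fin n → ℝ) i) ^ 2 :=
        mul_nonneg (by positivity) (Finset.sum_nonneg fun i _ => sq_nonneg _)
      have h4 : 0 ≤ (∑ i, ((-(s • ζ)) i - (-(s • ξ)) i) ^ 2) / (8 * a) :=
        div_nonneg (Finset.sum_nonneg fun i _ => sq_nonneg _) (by positivity)
      linarith
    calc _ ≤ gaussConst n (2 * a) * Real.exp (-(c ^ 2 / (8 * a)) * ∑ i, (ξ i - ζ i) ^ 2) *
          (‖gaussWeight K d z‖ * (gaussConst n (2 * a) * 1)) := by gcongr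
      _ = _ := by ring

end Dilatation

/-! ### Recovering Gaussian matrix elements from the characteristic function -/

section Moyal

variable {n : ℕ}

theorem IsTraceClass.exists_tsum {H : Type*} [NormedAddCommGroup H] [InnerProductSpace ℂ H]
    [CompleteSpace H] {X : H →L[ℂ] H} [Countable (basisIndex H)] (h : IsTraceClass X) :
    ∃ p q : basisIndex H → H, (Summable fun t => ‖p t‖ * ‖q t‖) ∧
      (∀ φ ψ, ⟪φ, X ψ⟫_ℂ = ∑' t, ⟪φ, p t⟫_ℂ * ⟪q t, ψ⟫_ℂ) ∧
      ∀ W : H →L[ℂ] H, trace (X ∘L W) = ∑' t, ⟪q t, W (p t)⟫_ℂ := by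
  obtain ⟨p, q, h1, -⟩ := h.exists_isNuclear
  let _ : MeasurableSpace (basisIndex H) := ⊤
  have hs : Summable fun t => ‖p t‖ * ‖q t‖ := by
    simpa [integrable_count_iff] using h1.integrable_norm
  refine ⟨p, q, hs, fun φ ψ => ?_, fun W => ?_⟩
  · rw [h1.inner_apply, integral_countable (h1.integrable_inner φ ψ)]
    simp [Measure.real]
  · have hi : Integrable (fun t => ⟪q t, W (p t)⟫_ℂ) (basisCount H) := by
      refine (h1.integrable_norm.const_mul ‖W‖).mono' .of_discrete (.of_forall fun t => ?_)
      calc _ ≤ ‖q t‖ * ‖W (p t)‖ := norm_inner_le_norm _ _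
        _ ≤ ‖q t‖ * (‖W‖ * ‖p t‖) := by gcongr; exact W.le_opNorm _
        _ = _ := by ring
    rw [h1.trace_comp, integral_countable hi]
    simp [Measure.real]

/-- The position part of the Weyl symbol of `|gauss 0 ξ⟩⟨gauss 0 ζ|`. -/
noncomputable def moyalLeft (a : ℝ) (ξ ζ α : Fin n → ℝ) : ℂ :=
  ((gaussConst n (1 / (8 * a)) : ℝ) : ℂ)⁻¹ *
    Complex.exp (∑ i, (-((1 / (8 * a) : ℝ) : ℂ) * (α i : ℂ) ^ 2 +
      ((ξ i - ζ i) / (4 * a)) * α i + -(ξ i - ζ i) ^ 2 / (8 * a)))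

/-- The momentum part of the Weyl symbol of `|gauss 0 ξ⟩⟨gauss 0 ζ|`. -/
noncomputable def moyalRight (a : ℝ) (ξ ζ β : Fin n → ℝ) : ℂ :=
  Complex.exp (∑ i, (-((a / 2 : ℝ) : ℂ) * (β i : ℂ) ^ 2 +
    (-(Complex.I / 2) * (ξ i + ζ i)) * β i + 0))

/-- The Weyl symbol of `|gauss 0 ξ⟩⟨gauss 0 ζ|`. -/
noncomputable def moyalKernel (a : ℝ) (ξ ζ : Fin n → ℝ) (k : Phase n) : ℂ :=
  moyalLeft a ξ ζ k.1 * moyalRight a ξ ζ k.2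

theorem integrable_moyalLeft {a : ℝ} (ha : 0 < a) (ξ ζ : Fin n → ℝ) :
    Integrable (moyalLeft a ξ ζ) :=
  (integrable_cexp_sum_quadratic (by positivity) _ _).const_mul _

theorem integrable_moyalRight {a : ℝ} (ha : 0 < a) (ξ ζ : Fin n → ℝ) :
    Integrable (moyalRight a ξ ζ) :=
  integrable_cexp_sum_quadratic (by positivity) _ _

theorem integrable_moyalKernel {a : ℝ} (ha : 0 < a) (ξ ζ : Fin n → ℝ) :
    Integrable (moyalKernel a ξ ζ) :=
  (integrable_moyalLeft ha ξ ζ).mul_prod (integrable_moyalRight ha ξ ζ)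

theorem integral_moyalLeft_mul {a : ℝ} (ha : 0 < a) (ξ ζ β x : Fin n → ℝ) :
    ∫ α, moyalLeft a ξ ζ α * weylPhase (α, β) x =
      Complex.exp (∑ i, (-(2 * a : ℂ) * (x i + β i / 2) ^ 2 +
        Complex.I * (ξ i - ζ i) * (x i + β i / 2))) := by
  have ha' : (a : ℂ) ≠ 0 := by exact_mod_cast ha.ne'
  have hg : (gaussConst n (1 / (8 * a)) : ℂ) ≠ 0 := by
    exact_mod_cast (gaussConst_pos (by positivity)).ne'
  have h : ∀ α : Fin n → ℝ, moyalLeft a ξ ζ α * weylPhase (α, β) x =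
      ((gaussConst n (1 / (8 * a)) : ℝ) : ℂ)⁻¹ *
    Complex.exp (∑ i, (-((1 / (8 * a) : ℝ) : ℂ) * (α i : ℂ) ^ 2 +
      ((ξ i - ζ i) / (4 * a) + Complex.I * (x i + β i / 2)) * α i +
        -(ξ i - ζ i) ^ 2 / (8 * a))) := by
    intro α
    rw [moyalLeft, weylPhase, mul_assoc, ← Complex.exp_add]
    congr 2
    simp only [dotProduct]
    push_cast
    rw [Finset.sum_div, ← Finset.sum_add_distrib, Finset.mul_sum, ← Finset.sum_add_distrib]
    refine Finset.sum_congr rfl fun i _ => ?_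
    ring
  simp_rw [h]
  rw [integral_const_mul, integral_cexp_sum_quadratic (by positivity), ← mul_assoc,
    inv_mul_cancel₀ hg, one_mul]
  congr 1
  refine Finset.sum_congr rfl fun i _ => ?_
  push_cast
  field_simp
  ring_nf
  simp only [Complex.I_sq]
  ring

theorem moyal_pointwise {a : ℝ} (ha : 0 < a) (ξ ζ β x : Fin n → ℝ) :
    moyalRight a ξ ζ β * ∫ α, moyalLeft a ξ ζ α * weylPhase (α, β) x =
      gaussFun a 0 ξ x * (starRingEnd ℂ) (gaussFun a 0 ζ (x + β)) := by
  rw [integral_moyalLeft_mul ha, conj_gaussFun, moyalRight, gaussFun, ← Complex.exp_add,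
    ← Complex.exp_add, ← Finset.sum_add_distrib, ← Finset.sum_add_distrib]
  congr 1
  refine Finset.sum_congr rfl fun i _ => ?_
  simp only [Pi.add_apply, Pi.zero_apply]
  push_cast
  ring

theorem integrable_norm_sq (q : Hilb n) : Integrable fun x => ‖q x‖ ^ 2 :=
  (memLp_two_iff_integrable_sq_norm (Lp.aestronglyMeasurable q)).1 (Lp.memLp q)

/-- By AM-GM, `|q(x) p(x + β)|` is at most the mean of `|q(x)|²` and `|p(x + β)|²`; a
measure-preserving shear reduces the second to a product. -/
theorem integrable_mul_translate {F : (Fin n → ℝ) → ℂ} (hF : Integrable F) (p q : Hilb n) :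
    Integrable fun z : (Fin n → ℝ) × (Fin n → ℝ) =>
      F z.1 * ((starRingEnd ℂ) (q z.2) * p (z.2 + z.1)) := by
  have hq : StronglyMeasurable (q : (Fin n → ℝ) → ℂ) := Lp.stronglyMeasurable q
  have hp : StronglyMeasurable (p : (Fin n → ℝ) → ℂ) := Lp.stronglyMeasurable p
  have h1 : Integrable fun z : (Fin n → ℝ) × (Fin n → ℝ) => ‖F z.1‖ * ‖q z.2‖ ^ 2 :=
    hF.norm.mul_prod (integrable_norm_sq q)
  have h2 : Integrable fun z : (Fin n → ℝ) × (Fin n → ℝ) => ‖F z.1‖ * ‖p (z.2 + z.1)‖ ^ 2 := by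
    have h3 := (measurePreserving_prod_add (volume : Measure (Fin n → ℝ))
      (volume : Measure (Fin n → ℝ))).integrable_comp_of_integrable
        (hF.norm.mul_prod (integrable_norm_sq p))
    refine h3.congr (.of_forall fun z => ?_)
    simp [add_comm]
  refine ((h1.add h2).div_const 2).mono' ?_ (.of_forall fun z => ?_)
  · refine (hF.aestronglyMeasurable.comp_fst).mul ?_
    refine StronglyMeasurable.aestronglyMeasurable ?_
    exact (Complex.continuous_conj.comp_stronglyMeasurable
      (hq.comp_measurable measurable_snd)).mul
      (hp.comp_measurable (measurable_snd.add measurable_fst))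
  · simp only [norm_mul, RCLike.norm_conj, Pi.add_apply]
    nlinarith [mul_nonneg (norm_nonneg (F z.1)) (sq_nonneg (‖q z.2‖ - ‖p (z.2 + z.1)‖))]

theorem integrable_moyal {a : ℝ} (ha : 0 < a) (ξ ζ : Fin n → ℝ) (p q : Hilb n) :
    Integrable fun z : (Fin n → ℝ) × ((Fin n → ℝ) × (Fin n → ℝ)) =>
      weylPhase (z.1, z.2.1) z.2.2 * (moyalLeft a ξ ζ z.1 *
        (moyalRight a ξ ζ z.2.1 * ((starRingEnd ℂ) (q z.2.2) * p (z.2.2 + z.2.1)))) := by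
  refine ((integrable_moyalLeft ha ξ ζ).mul_prod
    (integrable_mul_translate (integrable_moyalRight ha ξ ζ) p q)).bdd_mul (c := 1) ?_
      (.of_forall fun z => (norm_weylPhase _ _).le)
  refine Continuous.aestronglyMeasurable ?_
  unfold weylPhase dotProduct
  fun_prop

/-- The integral over `α` turns the Weyl phase and the kernel into the product of Gaussians in
`moyal_pointwise`. Integrating over `β` with `x` fixed is then translation invariant, so the double
integral factors. Integrability of the kernel is what allows this formula to be summed over a
trace-class decomposition. -/
theorem moyal_identity {a : ℝ} (ha : 0 < a) (ξ ζ : Fin n → ℝ) (p q : Hilb n) :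
    Integrable (fun k : Phase n => moyalKernel a ξ ζ k * ⟪q, weyl k p⟫_ℂ) ∧
    ∫ k : Phase n, moyalKernel a ξ ζ k * ⟪q, weyl k p⟫_ℂ =
      ⟪gauss ha 0 ζ, p⟫_ℂ * ⟪q, gauss ha 0 ξ⟫_ℂ := by
  obtain ⟨Φ, hΦ⟩ : ∃ Φ : (Fin n → ℝ) × ((Fin n → ℝ) × (Fin n → ℝ)) → ℂ, Φ = fun z =>
      weylPhase (z.1, z.2.1) z.2.2 * (moyalLeft a ξ ζ z.1 *
        (moyalRight a ξ ζ z.2.1 * ((starRingEnd ℂ) (q z.2.2) * p (z.2.2 + z.2.1)))) := ⟨_, rfl⟩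
  have hI : Integrable Φ := hΦ ▸ integrable_moyal ha ξ ζ p q
  have hassoc := volume_preserving_prodAssoc (α₁ := Fin n → ℝ) (β₁ := Fin n → ℝ) (γ₁ := Fin n → ℝ)
  have hI' := hassoc.integrable_comp_of_integrable hI
  have h1 : ∀ k : Phase n, moyalKernel a ξ ζ k * ⟪q, weyl k p⟫_ℂ =
      ∫ x, (Φ ∘ MeasurableEquiv.prodAssoc) (k, x) := by
    intro k
    rw [inner_weyl, ← integral_const_mul]
    refine integral_congr_ae (.of_forall fun x => ?_)
    simp only [Function.comp_apply, MeasurableEquiv.prodAssoc, MeasurableEquiv.coe_mk,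
      Equiv.prodAssoc_apply, moyalKernel, hΦ]
    ring
  simp_rw [h1]
  refine ⟨hI'.integral_prod_left, ?_⟩
  rw [← integral_prod _ hI', ← Measure.volume_eq_prod]
  refine (hassoc.integral_comp (MeasurableEquiv.measurableEmbedding _) Φ).trans ?_
  rw [Measure.volume_eq_prod, integral_prod_symm _ hI]
  have h2 : ∀ y : (Fin n → ℝ) × (Fin n → ℝ), ∫ α, Φ (α, y) =
      ((starRingEnd ℂ) (q y.2) * gaussFun a 0 ξ y.2) *
        ((starRingEnd ℂ) (gaussFun a 0 ζ (y.2 + y.1)) * p (y.2 + y.1)) := by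
    intro y
    have h3 := moyal_pointwise ha ξ ζ y.1 y.2
    rw [← integral_const_mul] at h3
    calc _ = ∫ α, (moyalRight a ξ ζ y.1 * (moyalLeft a ξ ζ α * weylPhase (α, y.1) y.2)) *
          ((starRingEnd ℂ) (q y.2) * p (y.2 + y.1)) := by
          refine integral_congr_ae (.of_forall fun α => ?_)
          simp only [hΦ]
          ring
      _ = _ := by rw [integral_mul_const, h3]; ring
  have hI2 := hI.integral_prod_right
  simp only [h2] at hI2 ⊢
  rw [Measure.volume_eq_prod, integral_prod_symm _ hI2]
  have h4 : ⟪gauss ha 0 ζ, p⟫_ℂ = ∫ x, (starRingEnd ℂ) (gaussFun a 0 ζ x) * p x := by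
    rw [L2.inner_def]
    refine integral_congr_ae ?_
    filter_upwards [gauss_ae ha 0 ζ] with x hx
    rw [hx, RCLike.inner_apply, mul_comm]
  have h5 : ⟪q, gauss ha 0 ξ⟫_ℂ = ∫ x, (starRingEnd ℂ) (q x) * gaussFun a 0 ξ x := by
    rw [L2.inner_def]
    refine integral_congr_ae ?_
    filter_upwards [gauss_ae ha 0 ξ] with x hx
    rw [hx, RCLike.inner_apply, mul_comm]
  simp_rw [integral_const_mul]
  have h6 : ∀ x : Fin n → ℝ, ∫ β, (starRingEnd ℂ) (gaussFun a 0 ζ (x + β)) * p (x + β) =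
      ⟪gauss ha 0 ζ, p⟫_ℂ := fun x => by
    rw [h4, integral_add_left_eq_self (fun y => (starRingEnd ℂ) (gaussFun a 0 ζ y) * p y)]
  simp_rw [h6]
  rw [integral_mul_const, ← h5, mul_comm]

/-- Gaussian matrix elements of a trace-class operator in terms of its characteristic function. -/
theorem inner_gauss_eq_integral_charFn {a : ℝ} (ha : 0 < a) (ξ ζ : Fin n → ℝ)
    {Y : Hilb n →L[ℂ] Hilb n} (hY : IsTraceClass Y) :
    ⟪gauss ha 0 ζ, Y (gauss ha 0 ξ)⟫_ℂ = ∫ k, moyalKernel a ξ ζ k * charFn Y k := by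
  obtain ⟨p, q, hs, h1, h2⟩ := hY.exists_tsum
  have hi := fun t => (moyal_identity ha ξ ζ (p t) (q t)).1
  have hb : ∀ t, ∫ k, ‖moyalKernel a ξ ζ k * ⟪q t, weyl k (p t)⟫_ℂ‖ ≤
      (∫ k, ‖moyalKernel a ξ ζ k‖) * (‖p t‖ * ‖q t‖) := by
    intro t
    rw [← integral_mul_const]
    refine integral_mono (hi t).norm ((integrable_moyalKernel ha ξ ζ).norm.mul_const _) fun k => ?_
    beta_reduce
    rw [norm_mul]
    gcongr
    refine (norm_inner_le_norm _ _).trans ?_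
    rw [norm_weyl_apply, mul_comm]
  have hsum : Summable fun t => ∫ k, ‖moyalKernel a ξ ζ k * ⟪q t, weyl k (p t)⟫_ℂ‖ :=
    Summable.of_nonneg_of_le (fun t => integral_nonneg fun _ => norm_nonneg _) hb
      (hs.mul_left _)
  have h3 := (hasSum_integral_of_summable_integral_norm hi hsum).tsum_eq
  simp only [(moyal_identity ha ξ ζ (p _) (q _)).2] at h3
  rw [h1, h3]
  refine integral_congr_ae (.of_forall fun k => ?_)
  beta_reduce
  rw [charFn, h2, tsum_mul_left]

theorem integral_moyalKernel_neg {a : ℝ} (ha : 0 < a) (ξ : Fin n → ℝ) :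
    ∫ k, moyalKernel a ξ (-ξ) k = gaussConst n (a / 2) := by
  have h1 : ∫ α, moyalLeft a ξ (-ξ) α = 1 := by
    have := integral_moyalLeft_mul ha ξ (-ξ) 0 0
    simpa [weylPhase] using this
  have h2 : ∫ β, moyalRight a ξ (-ξ) β = gaussConst n (a / 2) := by
    unfold moyalRight
    rw [integral_cexp_sum_quadratic (by positivity)]
    simp
  unfold moyalKernel
  rw [Measure.volume_eq_prod, integral_prod_mul, h1, h2, one_mul]

end Moyal

/-! ### Separated momenta and the growth of the trace norm -/

section Unbounded

variable {n : ℕ}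

/-- Expand `⟪f, f⟫` for the sum `f`, apply Cauchy–Schwarz over the index and Bessel at `x = f`, then
cancel `‖f‖²`. This gives the order `√N` of the rank-one operator. -/
theorem norm_sum_sq_le_of_bessel {H ι : Type*} [NormedAddCommGroup H] [InnerProductSpace ℂ H]
    (s : Finset ι) {u : ι → H} {K : ℝ} (hK : 0 ≤ K)
    (hu : ∀ x, ∑ i ∈ s, ‖⟪u i, x⟫_ℂ‖ ^ 2 ≤ K * ‖x‖ ^ 2) :
    ‖∑ i ∈ s, u i‖ ^ 2 ≤ s.card * K := by
  set f := ∑ i ∈ s, u i with hf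
  have h1 : ‖f‖ ^ 2 ≤ ∑ i ∈ s, ‖⟪u i, f⟫_ℂ‖ := by
    have h2 : (‖f‖ ^ 2 : ℝ) = ‖⟪f, f⟫_ℂ‖ := by
      rw [inner_self_eq_norm_sq_to_K]; simp
    rw [h2]
    nth_rw 1 [hf]
    rw [sum_inner]
    exact norm_sum_le _ _
  have h3 : (∑ i ∈ s, ‖⟪u i, f⟫_ℂ‖) ^ 2 ≤ s.card * (K * ‖f‖ ^ 2) :=
    sq_sum_le_card_mul_sum_sq.trans (mul_le_mul_of_nonneg_left (hu f) (Nat.cast_nonneg _))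
  have h4 : (‖f‖ ^ 2) ^ 2 ≤ s.card * (K * ‖f‖ ^ 2) :=
    (pow_le_pow_left₀ (by positivity) h1 2).trans h3
  rcases (sq_nonneg ‖f‖).eq_or_lt with h0 | h0
  · rw [← h0]; positivity
  · refine le_of_mul_le_mul_right ?_ h0
    linarith

/-- The momenta `R j e` for `j = 0, 1, 2, …`, along a coordinate vector `e`. -/
noncomputable def momentum (i₀ : Fin n) (R : ℝ) (j : ℕ) : Fin n → ℝ := Pi.single i₀ (R * j)

theorem sq_le_sum_momentum_sub_sq (i₀ : Fin n) (R : ℝ) {j k : ℕ} (hjk : j ≠ k) :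
    R ^ 2 ≤ ∑ i, (momentum i₀ R j i - momentum i₀ R k i) ^ 2 := by
  have h1 : (momentum i₀ R j i₀ - momentum i₀ R k i₀) ^ 2 = R ^ 2 * ((j : ℝ) - k) ^ 2 := by
    simp only [momentum, Pi.single_eq_same]; ring
  have h2 : (1 : ℝ) ≤ ((j : ℝ) - k) ^ 2 := by
    have : (1 : ℤ) ≤ ((j : ℤ) - k) ^ 2 := by
      have h3 : (j : ℤ) - k ≠ 0 := sub_ne_zero.2 (by exact_mod_cast hjk)
      have := pow_pos (abs_pos.2 h3) 2
      rw [sq_abs] at this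
      linarith
    exact_mod_cast this
  calc R ^ 2 ≤ R ^ 2 * ((j : ℝ) - k) ^ 2 := le_mul_of_one_le_right (sq_nonneg _) h2
    _ = _ := h1.symm
    _ ≤ _ := Finset.single_le_sum (f := fun i => (momentum i₀ R j i - momentum i₀ R k i) ^ 2)
      (fun i _ => sq_nonneg _) (Finset.mem_univ i₀)

/-- Gaussians with widely separated momenta satisfy Bessel's inequality. -/
theorem gauss_bessel {a : ℝ} (ha : 0 < a) (i₀ : Fin n) {r R : ℝ} {N : ℕ}
    (h : N * Real.exp (-(r ^ 2 / (8 * a) * R ^ 2)) ≤ 1) (x : Hilb n) :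
    ∑ j ∈ Finset.range N, ‖⟪gauss ha 0 (r • momentum i₀ R j), x⟫_ℂ‖ ^ 2 ≤
      2 * gaussConst n (2 * a) * ‖x‖ ^ 2 := by
  have hG : 0 < gaussConst n (2 * a) := gaussConst_pos (by positivity)
  refine sum_norm_inner_sq_le_of_gram _ _ (by positivity) (fun j hj => ?_) x
  rw [← Finset.add_sum_erase _ _ hj]
  have h1 : ‖⟪gauss ha 0 (r • momentum i₀ R j), gauss ha 0 (r • momentum i₀ R j)⟫_ℂ‖ =
      gaussConst n (2 * a) := by
    rw [norm_inner_gauss_gauss]; simp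
  have h2 : ∀ k ∈ (Finset.range N).erase j,
      ‖⟪gauss ha 0 (r • momentum i₀ R j), gauss ha 0 (r • momentum i₀ R k)⟫_ℂ‖ ≤
        gaussConst n (2 * a) * Real.exp (-(r ^ 2 / (8 * a) * R ^ 2)) := by
    intro k hk
    rw [norm_inner_gauss_gauss]
    refine mul_le_mul_of_nonneg_left (Real.exp_le_exp.2 ?_) hG.le
    have h3 := mul_le_mul_of_nonneg_left (sq_le_sum_momentum_sub_sq i₀ R (Finset.ne_of_mem_erase hk))
      (show 0 ≤ r ^ 2 / (8 * a) by positivity)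
    have h4 : (∑ i, ((r • momentum i₀ R k) i - (r • momentum i₀ R j) i) ^ 2) / (8 * a) =
        r ^ 2 / (8 * a) * ∑ i, (momentum i₀ R k i - momentum i₀ R j i) ^ 2 := by
      rw [Finset.sum_div, Finset.mul_sum]
      refine Finset.sum_congr rfl fun i _ => ?_
      simp only [Pi.smul_apply, smul_eq_mul]; ring
    rw [h4]
    simpa using h3
  have h3 := Finset.sum_le_card_nsmul _ _ _ h2
  rw [h1, nsmul_eq_mul] at *
  have h5 : (((Finset.range N).erase j).card : ℝ) ≤ N := by
    exact_mod_cast (Finset.card_erase_le).trans (Finset.card_range N).le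
  have h6 : (((Finset.range N).erase j).card : ℝ) *
      (gaussConst n (2 * a) * Real.exp (-(r ^ 2 / (8 * a) * R ^ 2))) ≤ gaussConst n (2 * a) := by
    calc _ ≤ (N : ℝ) * (gaussConst n (2 * a) * Real.exp (-(r ^ 2 / (8 * a) * R ^ 2))) := by gcongr
      _ = gaussConst n (2 * a) * (N * Real.exp (-(r ^ 2 / (8 * a) * R ^ 2))) := by ring
      _ ≤ gaussConst n (2 * a) * 1 := by gcongr
      _ = _ := mul_one _
  linarith

theorem eventually_mul_exp_neg_le {κ δ : ℝ} (B : ℝ) (hκ : 0 < κ) (hδ : 0 < δ) :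
    ∀ᶠ R : ℝ in Filter.atTop, B * Real.exp (-(κ * R ^ 2)) ≤ δ := by
  have h1 : Filter.Tendsto (fun R : ℝ => κ * R ^ 2) Filter.atTop Filter.atTop :=
    (Filter.tendsto_pow_atTop two_ne_zero).const_mul_atTop hκ
  have h2 := (Real.tendsto_exp_neg_atTop_nhds_zero.comp h1).const_mul B
  rw [mul_zero] at h2
  exact (h2.eventually (ge_mem_nhds hδ))

/-- It replaces an unknown trace-class image by the explicit one in every Gaussian matrix element,
so full injectivity of `charFn` is not needed. -/
theorem inner_gauss_congr_charFn {a : ℝ} (ha : 0 < a) (ξ ζ : Fin n → ℝ)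
    {Y Y' : Hilb n →L[ℂ] Hilb n} (hY : IsTraceClass Y) (hY' : IsTraceClass Y')
    (h : ∀ k, charFn Y k = charFn Y' k) :
    ⟪gauss ha 0 ζ, Y (gauss ha 0 ξ)⟫_ℂ = ⟪gauss ha 0 ζ, Y' (gauss ha 0 ξ)⟫_ℂ := by
  rw [inner_gauss_eq_integral_charFn ha ξ ζ hY, inner_gauss_eq_integral_charFn ha ξ ζ hY']
  simp_rw [h]

/-- A trace-class operator does not have a nonzero constant characteristic function. -/
theorem IsTraceClass.eq_zero_of_charFn_const (hn : 1 ≤ n) {Y : Hilb n →L[ℂ] Hilb n}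
    (hY : IsTraceClass Y) {χ : ℂ} (h : ∀ k, charFn Y k = χ) : χ = 0 := by
  by_contra hχ
  have ha : (0 : ℝ) < 1 := one_pos
  let i₀ : Fin n := ⟨0, hn⟩
  set G := gaussConst n (2 * 1)
  have hG : 0 < G := gaussConst_pos (by norm_num)
  set g := gaussConst n (1 / 2)
  have hg : 0 < g := gaussConst_pos (by norm_num)
  have hel : ∀ ξ : Fin n → ℝ, ‖⟪gauss ha 0 (-ξ), Y (gauss ha 0 ξ)⟫_ℂ‖ = g * ‖χ‖ := by
    intro ξ
    rw [inner_gauss_eq_integral_charFn ha ξ (-ξ) hY]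
    simp_rw [h]
    rw [integral_mul_const, integral_moyalKernel_neg ha, norm_mul, Complex.norm_real,
      Real.norm_of_nonneg hg.le]
  -- `N` matrix elements of modulus `g ‖χ‖` along two families with Bessel constant `2 G` would
  -- force `N g ‖χ‖ ≤ 2 G ‖Y‖₁`.
  obtain ⟨N, hN⟩ := exists_nat_gt (2 * G * (traceNorm Y).toReal / (g * ‖χ‖))
  have hχ0 : 0 < g * ‖χ‖ := mul_pos hg (norm_pos_iff.2 hχ)
  rw [div_lt_iff₀ hχ0] at hN
  obtain ⟨R, hR⟩ := (eventually_mul_exp_neg_le (κ := 1 / (8 * 1)) N (by norm_num) one_pos).exists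
  have h1 := hY.sum_norm_inner_le (Finset.range N) (by positivity)
    (gauss_bessel ha i₀ (r := -1) (R := R) (by simpa using hR))
    (gauss_bessel ha i₀ (r := 1) (R := R) (by simpa using hR))
  simp only [neg_smul, one_smul, hel, Finset.sum_const, Finset.card_range, nsmul_eq_mul] at h1
  linarith

theorem isDilatation_sum {l : ℝ} {ι : Type*} (s : Finset ι) {X Y : ι → Hilb n →L[ℂ] Hilb n}
    (hX : ∀ j ∈ s, IsTraceClass (X j)) (hY : ∀ j ∈ s, IsTraceClass (Y j))
    (h : ∀ j ∈ s, IsDilatation l (X j) (Y j)) :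
    IsDilatation l (∑ j ∈ s, X j) (∑ j ∈ s, Y j) := by
  intro k
  rw [charFn, charFn, trace_sum_comp s hX, trace_sum_comp s hY]
  exact Finset.sum_congr rfl fun j hj => h j hj k

/-- The trace norm of every trace-class dilatation of a suitable trace-class operator is large. -/
theorem exists_traceNorm_lt (hn : 1 ≤ n) {l : ℝ} (hl0 : l ≠ 0) (hl : l ≠ 1) (hl' : l ≠ -1)
    (C : ℝ≥0) : ∃ X : Hilb n →L[ℂ] Hilb n, IsTraceClass X ∧
      (∃ Y : Hilb n →L[ℂ] Hilb n, IsTraceClass Y ∧ IsDilatation l X Y) ∧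
      ∀ Y : Hilb n →L[ℂ] Hilb n, IsTraceClass Y → IsDilatation l X Y →
        (C : ℝ≥0∞) * traceNorm X < traceNorm Y := by
  obtain ⟨a, c, s, D, M, ha, hc, hs, hD, hM, hex⟩ := exists_dilatation_gauss hl0 hl hl' n
  let i₀ : Fin n := ⟨0, hn⟩
  set G := gaussConst n (2 * a) with hG
  have hG0 : 0 < G := gaussConst_pos (by positivity)
  set G' := gaussConst n (2 * (1 / 2)) with hG'
  have hG'0 : 0 < G' := gaussConst_pos (by norm_num)
  -- With `N = m²`, the bounds will be `‖X‖₁ ≤ m √(2 G') √G'` and `m² D ≤ 4 G ‖Y‖₁`; this choice of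
  -- `m` makes the second beat `C` times the first.
  obtain ⟨m, hm⟩ := exists_nat_gt (C * (√(2 * G') * √G') * (4 * G) / D)
  have hm0 : (0 : ℝ) < m := lt_of_le_of_lt (by positivity) hm
  rw [div_lt_iff₀ hD] at hm
  set N := m ^ 2 with hN
  -- The spacing `R` gives Bessel bounds for the kets of `X` and for the momenta `c ξ` and `-s ξ` of
  -- its image. The last condition keeps the total off-diagonal contribution below `D / 2`.
  obtain ⟨R, hR1, hR2, hR3, hR4⟩ := ((eventually_mul_exp_neg_le (κ := 1 ^ 2 / (8 * (1 / 2))) N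
    (by norm_num) one_pos).and ((eventually_mul_exp_neg_le (κ := c ^ 2 / (8 * a)) N
    (by positivity) one_pos).and ((eventually_mul_exp_neg_le (κ := (-s) ^ 2 / (8 * a)) N
    (div_pos (by rw [neg_sq]; positivity) (by positivity)) one_pos).and
    (eventually_mul_exp_neg_le (κ := c ^ 2 / (8 * a)) (N * M)
    (by positivity) (half_pos hD))))).exists
  choose Y₀ hY₀ hdil hdiag hoff using fun j : ℕ => hex (momentum i₀ R j)
  set X₀ : ℕ → Hilb n →L[ℂ] Hilb n := fun j => InnerProductSpace.rankOne ℂ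
    (gauss one_half_pos 0 (momentum i₀ R j)) (gauss one_half_pos 0 0) with hX₀
  have hX₀t : ∀ j ∈ Finset.range N, IsTraceClass (X₀ j) := fun j _ =>
    (isNuclear_rankOne _ _).isTraceClass
  have hdilS := isDilatation_sum (Finset.range N) hX₀t (fun j _ => hY₀ j) (fun j _ => hdil j)
  have hYt := isTraceClass_sum (Finset.range N) (fun j _ => hY₀ j)
  refine ⟨∑ j ∈ Finset.range N, X₀ j, isTraceClass_sum _ hX₀t, ⟨_, hYt, hdilS⟩, fun Y hY hYd => ?_⟩
  have hlow : ∀ i ∈ Finset.range N, D / 2 ≤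
      ‖⟪gauss ha 0 (c • momentum i₀ R i), Y (gauss ha 0 ((-s) • momentum i₀ R i))⟫_ℂ‖ := by
    intro i hi
    rw [inner_gauss_congr_charFn ha _ _ hY hYt fun k => (hYd k).trans (hdilS k).symm,
      sum_apply, inner_sum, ← Finset.add_sum_erase _ _ hi, neg_smul, hdiag]
    have h1 : ∀ j ∈ (Finset.range N).erase i,
        ‖⟪gauss ha 0 (c • momentum i₀ R i), Y₀ j (gauss ha 0 (-(s • momentum i₀ R i)))⟫_ℂ‖ ≤
          M * Real.exp (-(c ^ 2 / (8 * a) * R ^ 2)) := by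
      intro j hj
      refine (hoff j _).trans ?_
      gcongr
      rw [neg_mul, neg_le_neg_iff]
      gcongr
      exact sq_le_sum_momentum_sub_sq i₀ R (Finset.ne_of_mem_erase hj)
    have h2 : ‖∑ j ∈ (Finset.range N).erase i,
        ⟪gauss ha 0 (c • momentum i₀ R i), Y₀ j (gauss ha 0 (-(s • momentum i₀ R i)))⟫_ℂ‖ ≤
          D / 2 := by
      refine (norm_sum_le _ _).trans ((Finset.sum_le_card_nsmul _ _ _ h1).trans ?_)
      have h5 : (((Finset.range N).erase i).card : ℝ) ≤ N := by
        exact_mod_cast (Finset.card_erase_le).trans (Finset.card_range N).le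
      rw [nsmul_eq_mul]
      calc _ ≤ (N : ℝ) * (M * Real.exp (-(c ^ 2 / (8 * a) * R ^ 2))) := by gcongr
        _ ≤ _ := by rw [← mul_assoc]; exact hR4
    have h3 := norm_sub_le_norm_add (D : ℂ) (∑ j ∈ (Finset.range N).erase i,
      ⟪gauss ha 0 (c • momentum i₀ R i), Y₀ j (gauss ha 0 (-(s • momentum i₀ R i)))⟫_ℂ)
    rw [Complex.norm_real, Real.norm_of_nonneg hD.le] at h3
    linarith
  have hYlow : (N : ℝ) * (D / 2) ≤ 2 * G * (traceNorm Y).toReal := by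
    have h1 := hY.sum_norm_inner_le (Finset.range N) (by positivity)
      (gauss_bessel ha i₀ hR2) (gauss_bessel ha i₀ hR3)
    refine le_trans ?_ h1
    simpa using Finset.card_nsmul_le_sum _ _ _ hlow
  set f := ∑ j ∈ Finset.range N, gauss one_half_pos 0 (momentum i₀ R j) with hf
  have hXf : ∑ j ∈ Finset.range N, X₀ j =
      InnerProductSpace.rankOne ℂ f (gauss one_half_pos 0 0) := by
    rw [hf, map_sum, sum_apply]
  have hfn : ‖f‖ ≤ m * √(2 * G') := by
    have h1 := norm_sum_sq_le_of_bessel (Finset.range N) (by positivity)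
      (gauss_bessel one_half_pos i₀ hR1)
    simp only [one_smul, Finset.card_range] at h1
    refine le_of_sq_le_sq ?_ (by positivity)
    rw [mul_pow, Real.sq_sqrt (by positivity)]
    refine h1.trans (le_of_eq ?_)
    rw [hN]; push_cast; ring
  have hgn : ‖gauss one_half_pos (0 : Fin n → ℝ) 0‖ = √G' := by
    rw [hG', ← norm_gauss_sq one_half_pos (0 : Fin n → ℝ) 0, Real.sqrt_sq (norm_nonneg _)]
  have hXn : traceNorm (∑ j ∈ Finset.range N, X₀ j) ≤ ENNReal.ofReal (m * √(2 * G') * √G') := by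
    rw [hXf]
    refine (isNuclear_rankOne _ _).traceNorm_le.trans (ENNReal.ofReal_le_ofReal ?_)
    rw [integral_dirac, hgn]
    gcongr
  calc (C : ℝ≥0∞) * traceNorm (∑ j ∈ Finset.range N, X₀ j)
      ≤ C * ENNReal.ofReal (m * √(2 * G') * √G') := by gcongr
    _ = ENNReal.ofReal (C * (m * √(2 * G') * √G')) := by
        rw [ENNReal.ofReal_mul (NNReal.coe_nonneg C), ENNReal.ofReal_coe_nnreal]
    _ < ENNReal.ofReal (traceNorm Y).toReal := by
        refine (ENNReal.ofReal_lt_ofReal_iff_of_nonneg (by positivity)).2 ?_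
        have h1 : (m : ℝ) ^ 2 * D ≤ 4 * G * (traceNorm Y).toReal := by
          rw [hN] at hYlow; push_cast at hYlow; linarith
        have h2 := mul_lt_mul_of_pos_left hm hm0
        refine lt_of_mul_lt_mul_left (a := 4 * G) ?_ (by positivity)
        nlinarith
    _ = traceNorm Y := ENNReal.ofReal_toReal hY.ne

end Unbounded

end PhaseSpace

/-! ### The theorem: the cases `l = 0` and `l ≠ 0` -/

theorem mainTheorem11 (n : ℕ) (hn : 1 ≤ n) (l : ℝ) (hl : l ≠ 1) (hl' : l ≠ -1) :
    (¬ ∃ C : ℝ≥0, ∀ X : PhaseSpace.Hilb n →L[ℂ] PhaseSpace.Hilb n, PhaseSpace.IsTraceClass X →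
      ∃ Y : PhaseSpace.Hilb n →L[ℂ] PhaseSpace.Hilb n, PhaseSpace.IsTraceClass Y ∧
        PhaseSpace.IsDilatation l X Y ∧
        PhaseSpace.traceNorm Y ≤ (C : ℝ≥0∞) * PhaseSpace.traceNorm X) ∧
    (l ≠ 0 → ∀ C : ℝ≥0, ∃ X Y : PhaseSpace.Hilb n →L[ℂ] PhaseSpace.Hilb n,
      PhaseSpace.IsTraceClass X ∧ PhaseSpace.IsTraceClass Y ∧ PhaseSpace.IsDilatation l X Y ∧
        (C : ℝ≥0∞) * PhaseSpace.traceNorm X < PhaseSpace.traceNorm Y) := by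
  refine ⟨?_, fun hl0 C => ?_⟩
  · rintro ⟨C, hC⟩
    by_cases hl0 : l = 0
    -- At `l = 0` the image of `|g⟩⟨g|` has constant characteristic function `⟪g, g⟫`, which would
    -- have to vanish.
    · set g : PhaseSpace.Hilb n := PhaseSpace.gauss one_half_pos 0 0 with hg
      obtain ⟨Y, hY, hd, -⟩ := hC (InnerProductSpace.rankOne ℂ g g)
        (PhaseSpace.isNuclear_rankOne g g).isTraceClass
      have h1 : ∀ k, PhaseSpace.charFn Y k = ⟪g, g⟫_ℂ := fun k => by
        rw [hd k, hl0, zero_smul, PhaseSpace.charFn_rankOne, PhaseSpace.weyl_zero]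
      have h2 := inner_self_eq_zero.1 (hY.eq_zero_of_charFn_const hn h1)
      have h3 := PhaseSpace.norm_gauss_sq (n := n) one_half_pos 0 0
      rw [← hg, h2, norm_zero] at h3
      have h4 := PhaseSpace.gaussConst_pos (n := n) (b := 2 * (1 / 2)) (by norm_num)
      rw [← h3] at h4
      norm_num at h4
    · obtain ⟨X, hX, -, hlt⟩ := PhaseSpace.exists_traceNorm_lt hn hl0 hl hl' C
      obtain ⟨Y, hY, hd, hle⟩ := hC X hX
      exact (hlt Y hY hd).not_ge hle
  · obtain ⟨X, hX, ⟨Y, hY, hd⟩, hlt⟩ := PhaseSpace.exists_traceNorm_lt hn hl0 hl hl' C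
    exact ⟨X, Y, hX, hY, hd, hlt Y hY hd⟩
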